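/- Let $n\ge 0$, let $F_n$ be the free group on $n$ letters, and let $G$ be a finite subgroup of $\mathrm{Aut}(F_n)$. A pointed marked graph $\sigma=[s,\Gamma]$ is a finite connected graph $\Gamma$ with a base vertex $*$, without free edges (no vertex of valence one), in which every vertex other than $*$ has valence at least three, together with an isomorphism $s\colon F_n\to\pi_1(\Gamma,*)$. A pointed marked $G$-graph is a pointed marked graph with an action of $G$ on $\Gamma$ by graph automorphisms fixing $*$ such that each $x\in G$ acts on $\pi_1(\Gamma,*)$ as $s x s^{-1}$. Two of them are equivalent if there is a basepoint-preserving, $G$-equivariant graph isomorphism which is compatible with the markings; we consider pointed marked $G$-graphs up to equivalence. Fix an enumeration $w_1,w_2,\dots$ of the set of conjugacy classes of $F_n$ and an enumeration $\alpha_1,\alpha_2,\dots$ of $F_n$ (repetitions are allowed). The out-norm $\|\sigma\|_{out}$ is the integer sequence whose $i$th term is the sum over $x\in G$ of the numbers of edges in the cyclically reduced loops of $\Gamma$ representing $s(xw_i)$ (edges of $\Gamma$ are counted also if $*$ has valence two). The aut-norm $\|\sigma\|_{aut}$ is the integer sequence whose $i$th term is the sum over $x\in G$ of the numbers of edges in the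 reduced (not cyclically reduced) closed edge paths at $*$ representing $s(x\alpha_i)$. Order integer sequences lexicographically. The tot-norm is the pair $\|\sigma\|_{tot}=(\|\sigma\|_{out},\|\sigma\|_{aut})$, and such pairs are ordered lexicographically. Then the set of (equivalence classes of) pointed marked $G$-graphs is well-ordered by the tot-norm: the relation $\|\sigma\|_{tot}<\|\tau\|_{tot}$ is a well-order on this set. That is, two pointed marked $G$-graphs with the same tot-norm are equivalent, and every nonempty set of pointed marked $G$-graphs has an element of least tot-norm. -/

import Mathlib

/-- A graph in the sense of Serre: `E` is the set of oriented edges, `rev` reverses an edge,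
`src` is the initial vertex. Loops and multiple edges are allowed. -/
structure SerreGraph where
  V : Type
  E : Type
  src : E → V
  rev : E → E
  rev_rev : ∀ e, rev (rev e) = e
  rev_ne : ∀ e, rev e ≠ e

namespace SerreGraph

/-- Terminal vertex of an oriented edge. -/
def tgt (Γ : SerreGraph) (e : Γ.E) : Γ.V := Γ.src (Γ.rev e)

/-- The valence of a vertex (a loop counts twice, once for each orientation). -/
noncomputable def valence (Γ : SerreGraph) (v : Γ.V) : ℕ := Nat.card {e : Γ.E // Γ.src e = v}

/-- `Γ.IsPath u p v`: the list of oriented edges `p` is an edge path from `u` to `v`. -/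
def IsPath (Γ : SerreGraph) : Γ.V → List Γ.E → Γ.V → Prop
  | u, [], v => u = v
  | u, e :: p, v => Γ.src e = u ∧ Γ.IsPath (Γ.tgt e) p v

/-- The edge path traversed backwards. -/
def inv (Γ : SerreGraph) (p : List Γ.E) : List Γ.E := (p.map Γ.rev).reverse

/-- An edge path is reduced if no edge is immediately followed by its reverse. -/
def Reduced (Γ : SerreGraph) (p : List Γ.E) : Prop := p.IsChain (fun a b => b ≠ Γ.rev a)

theorem isPath_append (Γ : SerreGraph) {u v w : Γ.V} {p q : List Γ.E}
    (hp : Γ.IsPath u p v) (hq : Γ.IsPath v q w) : Γ.IsPath u (p ++ q) w := by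
  induction p generalizing u with
  | nil => cases hp; exact hq
  | cons e p ih => exact ⟨hp.1, ih hp.2⟩

theorem isPath_inv (Γ : SerreGraph) {u v : Γ.V} {p : List Γ.E}
    (hp : Γ.IsPath u p v) : Γ.IsPath v (Γ.inv p) u := by
  induction p generalizing u with
  | nil => exact Eq.symm hp
  | cons e p ih =>
    have h := Γ.isPath_append (ih hp.2) (q := [Γ.rev e]) (w := u)
      ⟨rfl, by simp only [IsPath, tgt, Γ.rev_rev]; exact hp.1⟩
    simpa [inv] using h

/-- Closed edge paths based at `v`. -/
def ClosedPath (Γ : SerreGraph) (v : Γ.V) : Type := {p : List Γ.E // Γ.IsPath v p v}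

/-- Deletion of one backtracking `e ē`. -/
def Backtrack (Γ : SerreGraph) (p q : List Γ.E) : Prop :=
  ∃ (a b : List Γ.E) (e : Γ.E), p = a ++ e :: Γ.rev e :: b ∧ q = a ++ b

/-- The fundamental group of the graph at `v`: closed edge paths at `v` modulo the equivalence
relation generated by deleting backtrackings. -/
def Pi1 (Γ : SerreGraph) (v : Γ.V) : Type :=
  Quot (fun p q : Γ.ClosedPath v => Γ.Backtrack p.1 q.1)

/-- The homotopy class of a closed edge path. -/
def Pi1.mk {Γ : SerreGraph} {v : Γ.V} (p : Γ.ClosedPath v) : Γ.Pi1 v := Quot.mk _ p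

theorem backtrack_inv (Γ : SerreGraph) {p q : List Γ.E} (h : Γ.Backtrack p q) :
    Γ.Backtrack (Γ.inv p) (Γ.inv q) := by
  obtain ⟨a, b, e, rfl, rfl⟩ := h
  refine ⟨Γ.inv b, Γ.inv a, e, ?_, ?_⟩
  · simp [inv, Γ.rev_rev]
  · simp [inv]

theorem backtrack_append_left (Γ : SerreGraph) {p q : List Γ.E} (r : List Γ.E)
    (h : Γ.Backtrack p q) : Γ.Backtrack (r ++ p) (r ++ q) := by
  obtain ⟨a, b, e, rfl, rfl⟩ := h
  exact ⟨r ++ a, b, e, by simp, by simp⟩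

theorem backtrack_append_right (Γ : SerreGraph) {p q : List Γ.E} (r : List Γ.E)
    (h : Γ.Backtrack p q) : Γ.Backtrack (p ++ r) (q ++ r) := by
  obtain ⟨a, b, e, rfl, rfl⟩ := h
  exact ⟨a, b ++ r, e, by simp, by simp⟩

theorem inv_mul_aux (Γ : SerreGraph) {u v : Γ.V} {p : List Γ.E} (hp : Γ.IsPath u p v) :
    Pi1.mk (⟨Γ.inv p ++ p, Γ.isPath_append (Γ.isPath_inv hp) hp⟩ : Γ.ClosedPath v) =
      Pi1.mk ⟨[], rfl⟩ := by
  induction p generalizing u with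
  | nil => rfl
  | cons e p ih =>
    rw [← ih hp.2]
    refine Quot.sound ⟨Γ.inv p, p, Γ.rev e, ?_, rfl⟩
    simp [inv, Γ.rev_rev]

/-- Multiplication is concatenation of paths, the inverse is the reversed path. -/
instance (Γ : SerreGraph) (v : Γ.V) : Group (Γ.Pi1 v) where
  mul := Quot.map₂ (fun p q => ⟨p.1 ++ q.1, Γ.isPath_append p.2 q.2⟩)
    (fun p _ _ h => Γ.backtrack_append_left p.1 h)
    (fun _ _ q h => Γ.backtrack_append_right q.1 h)
  one := Pi1.mk ⟨[], rfl⟩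
  inv := Quot.map (fun p => ⟨Γ.inv p.1, Γ.isPath_inv p.2⟩) (fun _ _ h => Γ.backtrack_inv h)
  mul_assoc := by
    rintro ⟨p⟩ ⟨q⟩ ⟨r⟩
    exact congrArg (Quot.mk _) (Subtype.ext (List.append_assoc p.1 q.1 r.1))
  one_mul := by
    rintro ⟨p⟩
    rfl
  mul_one := by
    rintro ⟨p⟩
    exact congrArg (Quot.mk _) (Subtype.ext (List.append_nil p.1))
  inv_mul_cancel := by
    rintro ⟨p⟩
    exact Γ.inv_mul_aux p.2

/-- The list of edges `p` is a closed path at `v` with homotopy class `γ`. -/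
def Represents (Γ : SerreGraph) {v : Γ.V} (γ : Γ.Pi1 v) (p : List Γ.E) : Prop :=
  ∃ h : Γ.IsPath v p v, Pi1.mk ⟨p, h⟩ = γ

/-- The length of the (unique) reduced closed edge path at `v` that represents `γ`. -/
noncomputable def pathLength (Γ : SerreGraph) {v : Γ.V} (γ : Γ.Pi1 v) : ℕ :=
  sInf {k | ∃ p : List Γ.E, Γ.Represents γ p ∧ Γ.Reduced p ∧ p.length = k}

/-- The length of the reduced loop that represents a conjugacy class `c` of the fundamental
group: a closed edge path `p`, based at an arbitrary vertex `u`, is freely homotopic to `c` if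
`q p q⁻¹` lies in `c` for some path `q` from `v` to `u`; it is cyclically reduced if `p p` is
reduced. All such `p` are cyclic permutations of one another, so they have the same length. -/
noncomputable def loopLength (Γ : SerreGraph) {v : Γ.V} (c : ConjClasses (Γ.Pi1 v)) : ℕ :=
  sInf {k | ∃ (u : Γ.V) (q p : List Γ.E) (γ : Γ.Pi1 v),
    Γ.IsPath v q u ∧ Γ.IsPath u p u ∧ Γ.Reduced (p ++ p) ∧
    Γ.Represents γ (q ++ p ++ Γ.inv q) ∧ ConjClasses.mk γ = c ∧ p.length = k}

/-- Isomorphisms of graphs (an edge may be sent to an edge with either orientation). -/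
@[ext]
structure Iso (Γ Δ : SerreGraph) where
  onV : Γ.V ≃ Δ.V
  onE : Γ.E ≃ Δ.E
  map_src : ∀ e, Δ.src (onE e) = onV (Γ.src e)
  map_rev : ∀ e, Δ.rev (onE e) = onE (Γ.rev e)

namespace Iso

variable {Γ Δ Θ : SerreGraph}

def refl (Γ : SerreGraph) : Iso Γ Γ := ⟨Equiv.refl _, Equiv.refl _, fun _ => rfl, fun _ => rfl⟩

def symm (f : Iso Γ Δ) : Iso Δ Γ where
  onV := f.onV.symm
  onE := f.onE.symm
  map_src e := by
    rw [Equiv.eq_symm_apply, ← f.map_src, Equiv.apply_symm_apply]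
  map_rev e := by
    rw [Equiv.eq_symm_apply, ← f.map_rev, Equiv.apply_symm_apply]

def trans (f : Iso Γ Δ) (g : Iso Δ Θ) : Iso Γ Θ where
  onV := f.onV.trans g.onV
  onE := f.onE.trans g.onE
  map_src e := by simp [g.map_src, f.map_src]
  map_rev e := by simp [g.map_rev, f.map_rev]

/-- The automorphism group of a graph, with composition of maps as product. -/
instance : Group (Iso Γ Γ) where
  mul f g := g.trans f
  one := refl Γ
  inv := symm
  mul_assoc _ _ _ := rfl
  one_mul _ := rfl
  mul_one _ := rfl
  inv_mul_cancel f := Iso.ext (Equiv.self_trans_symm f.onV) (Equiv.self_trans_symm f.onE)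

theorem isPath_map (f : Iso Γ Δ) {u v : Γ.V} {p : List Γ.E} (h : Γ.IsPath u p v) :
    Δ.IsPath (f.onV u) (p.map f.onE) (f.onV v) := by
  induction p generalizing u with
  | nil => exact congrArg f.onV h
  | cons e p ih =>
    refine ⟨by rw [f.map_src, h.1], ?_⟩
    have : Δ.tgt (f.onE e) = f.onV (Γ.tgt e) := by simp only [tgt, f.map_rev, f.map_src]
    rw [this]
    exact ih h.2

theorem map_inv (f : Iso Γ Δ) (p : List Γ.E) : (Γ.inv p).map f.onE = Δ.inv (p.map f.onE) := by
  simp [inv, f.map_rev]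

theorem backtrack_map (f : Iso Γ Δ) {p q : List Γ.E} (h : Γ.Backtrack p q) :
    Δ.Backtrack (p.map f.onE) (q.map f.onE) := by
  obtain ⟨a, b, e, rfl, rfl⟩ := h
  exact ⟨a.map f.onE, b.map f.onE, f.onE e, by simp [f.map_rev], by simp⟩

theorem reduced_map (f : Iso Γ Δ) {p : List Γ.E} (h : Γ.Reduced p) :
    Δ.Reduced (p.map f.onE) := by
  unfold Reduced at *
  rw [List.isChain_map]
  refine h.imp fun a b hab => ?_
  rw [f.map_rev]
  exact fun h' => hab (f.onE.injective h')

/-- The homomorphism of fundamental groups induced by an isomorphism that sends `v` to `w`. -/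
def mapPi1 (f : Iso Γ Δ) {v : Γ.V} {w : Δ.V} (h : f.onV v = w) : Γ.Pi1 v →* Δ.Pi1 w where
  toFun := Quot.map (fun p => ⟨p.1.map f.onE, h ▸ f.isPath_map p.2⟩)
    (fun _ _ hb => f.backtrack_map hb)
  map_one' := rfl
  map_mul' := by
    rintro ⟨p⟩ ⟨q⟩
    exact congrArg (Quot.mk _) (Subtype.ext List.map_append)

theorem represents_map (f : Iso Γ Δ) {v : Γ.V} {w : Δ.V} (h : f.onV v = w) {γ : Γ.Pi1 v}
    {p : List Γ.E} (hp : Γ.Represents γ p) :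
    Δ.Represents (f.mapPi1 h γ) (p.map f.onE) := by
  obtain ⟨hp, rfl⟩ := hp
  exact ⟨h ▸ f.isPath_map hp, rfl⟩

theorem symm_map (f : Iso Γ Δ) {v : Γ.V} {w : Δ.V} (h : f.onV v = w) :
    f.symm.onV w = v := by
  rw [← h]; exact f.onV.symm_apply_apply v

theorem mapPi1_symm (f : Iso Γ Δ) {v : Γ.V} {w : Δ.V} (h : f.onV v = w) (γ : Γ.Pi1 v) :
    f.symm.mapPi1 (f.symm_map h) (f.mapPi1 h γ) = γ := by
  obtain ⟨p⟩ := γ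
  refine congrArg (Quot.mk _) (Subtype.ext ?_)
  change List.map f.onE.symm (List.map f.onE p.1) = p.1
  simp

theorem pathLength_map (f : Iso Γ Δ) {v : Γ.V} {w : Δ.V} (h : f.onV v = w) (γ : Γ.Pi1 v) :
    Δ.pathLength (f.mapPi1 h γ) = Γ.pathLength γ := by
  have key : ∀ {Γ Δ : SerreGraph} (f : Iso Γ Δ) {v : Γ.V} {w : Δ.V} (h : f.onV v = w)
      (γ : Γ.Pi1 v) (k : ℕ),
      (∃ p : List Γ.E, Γ.Represents γ p ∧ Γ.Reduced p ∧ p.length = k) →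
      ∃ p : List Δ.E, Δ.Represents (f.mapPi1 h γ) p ∧ Δ.Reduced p ∧ p.length = k := by
    rintro Γ Δ f v w h γ k ⟨p, h1, h2, h3⟩
    exact ⟨p.map f.onE, f.represents_map h h1, f.reduced_map h2, by simpa using h3⟩
  unfold pathLength
  congr 1
  ext k
  refine ⟨fun hk => ?_, key f h γ k⟩
  have := key f.symm (f.symm_map h) _ k hk
  rwa [mapPi1_symm] at this

theorem loopLength_map (f : Iso Γ Δ) {v : Γ.V} {w : Δ.V} (h : f.onV v = w)
    (c : ConjClasses (Γ.Pi1 v)) :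
    Δ.loopLength (ConjClasses.map (f.mapPi1 h) c) = Γ.loopLength c := by
  have key : ∀ {Γ Δ : SerreGraph} (f : Iso Γ Δ) {v : Γ.V} {w : Δ.V} (h : f.onV v = w)
      (c : ConjClasses (Γ.Pi1 v)) (k : ℕ),
      (∃ (u : Γ.V) (q p : List Γ.E) (γ : Γ.Pi1 v),
        Γ.IsPath v q u ∧ Γ.IsPath u p u ∧ Γ.Reduced (p ++ p) ∧
        Γ.Represents γ (q ++ p ++ Γ.inv q) ∧ ConjClasses.mk γ = c ∧ p.length = k) →
      ∃ (u : Δ.V) (q p : List Δ.E) (γ : Δ.Pi1 w),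
        Δ.IsPath w q u ∧ Δ.IsPath u p u ∧ Δ.Reduced (p ++ p) ∧
        Δ.Represents γ (q ++ p ++ Δ.inv q) ∧
        ConjClasses.mk γ = ConjClasses.map (f.mapPi1 h) c ∧ p.length = k := by
    rintro Γ Δ f v w h c k ⟨u, q, p, γ, h1, h2, h3, h4, rfl, h6⟩
    refine ⟨f.onV u, q.map f.onE, p.map f.onE, f.mapPi1 h γ, h ▸ f.isPath_map h1,
      f.isPath_map h2, ?_, ?_, rfl, by simpa using h6⟩
    · simpa using f.reduced_map h3
    · have := f.represents_map h h4
      simpa [f.map_inv] using this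
  unfold loopLength
  congr 1
  ext k
  refine ⟨fun hk => ?_, key f h c k⟩
  have := key f.symm (f.symm_map h) _ k hk
  have hc : ConjClasses.map (f.symm.mapPi1 (f.symm_map h))
      (ConjClasses.map (f.mapPi1 h) c) = c := by
    obtain ⟨γ, rfl⟩ := ConjClasses.exists_rep c
    exact congrArg ConjClasses.mk (mapPi1_symm f h γ)
  rwa [hc] at this

end Iso

end SerreGraph

/-- A pointed marked graph of rank `n`: a finite connected graph with a base vertex, without
free edges (no vertex of valence one), all vertices other than the base vertex having valence at
least three, together with an identification of the free group `F_n` with its fundamental group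
at the base vertex. -/
structure PointedMarkedGraph (n : ℕ) where
  graph : SerreGraph
  finite_V : Finite graph.V
  finite_E : Finite graph.E
  base : graph.V
  connected : ∀ v, ∃ p, graph.IsPath base p v
  no_free_edge : ∀ v, graph.valence v ≠ 1
  three_le_valence : ∀ v, v ≠ base → 3 ≤ graph.valence v
  marking : FreeGroup (Fin n) ≃* graph.Pi1 base

/-- A pointed marked `G`-graph, for a group `G` of automorphisms of `F_n`: a pointed marked graph
with an action of `G` by basepoint-preserving graph automorphisms, such that `x ∈ G` induces the
automorphism `x` of `F_n` under the identification of `F_n` with the fundamental group. -/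
structure PointedMarkedGGraph {n : ℕ} (G : Subgroup (MulAut (FreeGroup (Fin n)))) extends
    PointedMarkedGraph n where
  act : G →* SerreGraph.Iso graph graph
  act_base : ∀ x, (act x).onV base = base
  act_marking : ∀ (x : G) (α : FreeGroup (Fin n)),
    (act x).mapPi1 (act_base x) (marking α) = marking ((x : MulAut (FreeGroup (Fin n))) α)

namespace PointedMarkedGGraph

variable {n : ℕ} {G : Subgroup (MulAut (FreeGroup (Fin n)))}

/-- Equivalence of pointed marked `G`-graphs: a basepoint-preserving isomorphism of graphs which
respects the markings and commutes with the actions of `G`. -/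
def Equivalent (σ τ : PointedMarkedGGraph G) : Prop :=
  ∃ (f : SerreGraph.Iso σ.graph τ.graph) (h : f.onV σ.base = τ.base),
    (∀ α, f.mapPi1 h (σ.marking α) = τ.marking α) ∧
    ∀ x : G, (σ.act x).trans f = f.trans (τ.act x)

theorem Equivalent.refl (σ : PointedMarkedGGraph G) : Equivalent σ σ := by
  refine ⟨SerreGraph.Iso.refl _, rfl, fun α => ?_, fun x => rfl⟩
  generalize σ.marking α = γ
  obtain ⟨p⟩ := γ
  exact congrArg (Quot.mk _) (Subtype.ext (List.map_id p.1))

theorem Equivalent.symm {σ τ : PointedMarkedGGraph G} (h : Equivalent σ τ) :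
    Equivalent τ σ := by
  obtain ⟨f, hb, hm, ha⟩ := h
  refine ⟨f.symm, f.symm_map hb, fun α => ?_, fun x => ?_⟩
  · rw [← hm, SerreGraph.Iso.mapPi1_symm]
  · have hx := ha x
    refine SerreGraph.Iso.ext (Equiv.ext fun v => ?_) (Equiv.ext fun e => ?_)
    · have := congrArg (fun g => g.onV (f.onV.symm v)) hx
      simp only [SerreGraph.Iso.trans, Equiv.trans_apply, Equiv.apply_symm_apply] at this
      change f.onV.symm ((τ.act x).onV v) = (σ.act x).onV (f.onV.symm v)
      rw [← this, Equiv.symm_apply_apply]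
    · have := congrArg (fun g => g.onE (f.onE.symm e)) hx
      simp only [SerreGraph.Iso.trans, Equiv.trans_apply, Equiv.apply_symm_apply] at this
      change f.onE.symm ((τ.act x).onE e) = (σ.act x).onE (f.onE.symm e)
      rw [← this, Equiv.symm_apply_apply]

theorem Equivalent.trans {σ τ ρ : PointedMarkedGGraph G} (h : Equivalent σ τ)
    (h' : Equivalent τ ρ) : Equivalent σ ρ := by
  obtain ⟨f, hb, hm, ha⟩ := h
  obtain ⟨g, hb', hm', ha'⟩ := h'
  refine ⟨f.trans g, by rw [← hb', ← hb]; rfl, fun α => ?_, fun x => ?_⟩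
  · rw [← hm', ← hm]
    generalize σ.marking α = γ
    obtain ⟨p⟩ := γ
    exact congrArg (Quot.mk _) (Subtype.ext
      (List.map_map (g := g.onE) (f := f.onE) (l := p.1)).symm)
  · change ((σ.act x).trans f).trans g = f.trans (g.trans (ρ.act x))
    rw [ha x, ← ha' x]
    rfl

instance setoid (G : Subgroup (MulAut (FreeGroup (Fin n)))) : Setoid (PointedMarkedGGraph G) where
  r := Equivalent
  iseqv := ⟨Equivalent.refl, Equivalent.symm, Equivalent.trans⟩

/-- The out-norm with respect to an enumeration `w` of the conjugacy classes of `F_n`. -/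
noncomputable def outNorm [Fintype G] (w : ℕ → ConjClasses (FreeGroup (Fin n)))
    (σ : PointedMarkedGGraph G) : Lex (ℕ → ℤ) :=
  toLex fun i => ∑ x : G, (σ.graph.loopLength (ConjClasses.map σ.marking.toMonoidHom
    (ConjClasses.map (x : MulAut (FreeGroup (Fin n))).toMonoidHom (w i))) : ℤ)

/-- The aut-norm with respect to an enumeration `a` of `F_n`. -/
noncomputable def autNorm [Fintype G] (a : ℕ → FreeGroup (Fin n))
    (σ : PointedMarkedGGraph G) : Lex (ℕ → ℤ) :=
  toLex fun i => ∑ x : G,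
    (σ.graph.pathLength (σ.marking ((x : MulAut (FreeGroup (Fin n))) (a i))) : ℤ)

/-- The tot-norm: the pair of the out-norm and the aut-norm, in the lexicographic product of the
two lexicographically ordered groups. -/
noncomputable def totNorm [Fintype G] (w : ℕ → ConjClasses (FreeGroup (Fin n)))
    (a : ℕ → FreeGroup (Fin n)) (σ : PointedMarkedGGraph G) : Lex (ℕ → ℤ) ×ₗ Lex (ℕ → ℤ) :=
  toLex (σ.outNorm w, σ.autNorm a)

theorem totNorm_congr [Fintype G] (w : ℕ → ConjClasses (FreeGroup (Fin n)))
    (a : ℕ → FreeGroup (Fin n)) (σ τ : PointedMarkedGGraph G) (h : Equivalent σ τ) :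
    σ.totNorm w a = τ.totNorm w a := by
  obtain ⟨f, hb, hm, -⟩ := h
  have h1 : σ.outNorm w = τ.outNorm w := by
    unfold outNorm
    congr 1
    funext i
    refine Finset.sum_congr rfl fun x _ => ?_
    rw [← f.loopLength_map hb]
    generalize ConjClasses.map (x : MulAut (FreeGroup (Fin n))).toMonoidHom (w i) = c
    obtain ⟨α, rfl⟩ := ConjClasses.exists_rep c
    exact congrArg (fun γ => (τ.graph.loopLength (ConjClasses.mk γ) : ℤ)) (hm α)
  have h2 : σ.autNorm a = τ.autNorm a := by
    unfold autNorm
    congr 1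
    funext i
    refine Finset.sum_congr rfl fun x _ => ?_
    rw [← f.pathLength_map hb, hm]
  unfold totNorm
  rw [h1, h2]

end PointedMarkedGGraph

/-- The set of equivalence classes of pointed marked `G`-graphs. -/
def PointedMarkedGGraphClass {n : ℕ} (G : Subgroup (MulAut (FreeGroup (Fin n)))) : Type 1 :=
  Quotient (PointedMarkedGGraph.setoid G)

/-- The tot-norm of an equivalence class. -/
noncomputable def PointedMarkedGGraphClass.totNorm {n : ℕ}
    {G : Subgroup (MulAut (FreeGroup (Fin n)))} [Fintype G]
    (w : ℕ → ConjClasses (FreeGroup (Fin n))) (a : ℕ → FreeGroup (Fin n))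
    (σ : PointedMarkedGGraphClass G) : Lex (ℕ → ℤ) ×ₗ Lex (ℕ → ℤ) :=
  Quotient.lift (PointedMarkedGGraph.totNorm w a) (PointedMarkedGGraph.totNorm_congr w a) σ

/-! An element x of G acts on the graph by an automorphism inducing x on F_n, so the |G| summands of
a norm coordinate are equal: a norm is |G| times a length function (`autNorm_apply`,
`outNorm_apply`).

For uniqueness the aut-norm alone suffices. Based lengths determine how far the reduced words of α
and β agree, since the length of α⁻¹β records the cancellation (`take_word_eq_iff`). Position k of α
and position l of β carry the same edge exactly when some γ follows α through position k and
continues like β from l, so coincidences of edges can be read off from lengths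
(`getElem?_word_eq_of_length_eq`). Every edge lies on a reduced closed path at the base point
(`exists_reduced_cons`), so matching equal positions of words is a bijection of edges; it extends to
an isomorphism that respects markings and the action of G.

Least elements need an argument, since the lexicographic order on sequences of natural numbers is
not well-founded. It is enough that bounding finitely many coordinates leaves finitely many norms
(`exists_forall_toLex_le`). If all generators have length at most B after a change of base point,
the based length function there depends only on their lengths and on which letters cancel, a finite
amount of data (`finite_setOf_length_basedWord`). This settles the aut-norm. For the out-norm,
bounds on the loops of generators and of products of two generators yield such a base point
(`exists_length_basedWord_le`), and the loop length is the growth rate of the lengths of powers,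
which moving the base point does not affect (`loopLength_le_of_length_basedWord`). -/

/-! ### Free reduction for an abstract cancellation relation -/

section FreeReduce

variable {A B : Type*}

open Classical in
/-- Prepend a letter to a word, cancelling it with the first letter if they are related. -/
noncomputable def cancelCons (R : A → A → Prop) (a : A) : List A → List A
  | [] => [a]
  | b :: l => if R a b then l else a :: b :: l

/-- Free reduction of a word, where `R a b` means that `b` cancels `a`. -/
noncomputable def freeReduce (R : A → A → Prop) : List A → List A
  | [] => []
  | a :: l => cancelCons R a (freeReduce R l)

/-- The map need not be injective: the course of the reduction depends only on which letters cancel.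
Hence the length of a reduced word can be computed on symbols standing for edges. -/
theorem freeReduce_map {R : A → A → Prop} {S : B → B → Prop} (f : A → B)
    (h : ∀ a b, R a b ↔ S (f a) (f b)) (l : List A) :
    freeReduce S (l.map f) = (freeReduce R l).map f := by
  induction l with
  | nil => rfl
  | cons a l ih =>
    simp only [List.map_cons, freeReduce, ih]
    cases freeReduce R l with
    | nil => rfl
    | cons b t =>
      by_cases hab : R a b
      · simp [cancelCons, hab, (h a b).1 hab]
      · simp [cancelCons, hab, mt (h a b).2 hab]

end FreeReduce

/-! ### Reduced edge paths and normal forms in the fundamental group -/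

namespace SerreGraph

variable (Γ : SerreGraph)

/-- Free reduction of an edge path. -/
noncomputable def red (p : List Γ.E) : List Γ.E := freeReduce (fun a b => b = Γ.rev a) p

variable {Γ}

theorem inv_append (p q : List Γ.E) : Γ.inv (p ++ q) = Γ.inv q ++ Γ.inv p := by
  simp [inv]

theorem inv_inv (p : List Γ.E) : Γ.inv (Γ.inv p) = p := by
  have h : Γ.rev ∘ Γ.rev = id := funext Γ.rev_rev
  simp [inv, h]

@[simp] theorem inv_nil : Γ.inv [] = [] := rfl

@[simp] theorem length_inv (p : List Γ.E) : (Γ.inv p).length = p.length := by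
  simp [inv]

theorem inv_cons (e : Γ.E) (p : List Γ.E) : Γ.inv (e :: p) = Γ.inv p ++ [Γ.rev e] := by
  simp [inv]

@[simp] theorem red_nil : Γ.red [] = [] := rfl

theorem red_cons (e : Γ.E) (p : List Γ.E) :
    Γ.red (e :: p) = cancelCons (fun a b => b = Γ.rev a) e (Γ.red p) := rfl

theorem Reduced.nil : Γ.Reduced [] := List.isChain_nil

theorem Reduced.tail {e : Γ.E} {p : List Γ.E} (h : Γ.Reduced (e :: p)) : Γ.Reduced p :=
  List.IsChain.tail h

theorem Reduced.left {p q : List Γ.E} (h : Γ.Reduced (p ++ q)) : Γ.Reduced p :=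
  (List.isChain_append.1 h).1

theorem Reduced.right {p q : List Γ.E} (h : Γ.Reduced (p ++ q)) : Γ.Reduced q :=
  (List.isChain_append.1 h).2.1

theorem Reduced.inv {p : List Γ.E} (h : Γ.Reduced p) : Γ.Reduced (Γ.inv p) := by
  unfold Reduced SerreGraph.inv at *
  rw [List.isChain_reverse, List.isChain_map]
  refine h.imp fun a b hab hba => hab ?_
  rw [Γ.rev_rev] at hba
  exact hba.symm

theorem Reduced.cancelCons {p : List Γ.E} (h : Γ.Reduced p) (e : Γ.E) :
    Γ.Reduced (cancelCons (fun a b => b = Γ.rev a) e p) := by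
  cases p with
  | nil => exact List.isChain_singleton e
  | cons f p =>
    simp only [_root_.cancelCons]
    split
    · exact h.tail
    · exact List.isChain_cons_cons.2 ⟨‹_›, h⟩

theorem reduced_red (p : List Γ.E) : Γ.Reduced (Γ.red p) := by
  induction p with
  | nil => exact Reduced.nil
  | cons e p ih => exact ih.cancelCons e

theorem Reduced.red_eq {p : List Γ.E} (h : Γ.Reduced p) : Γ.red p = p := by
  induction p with
  | nil => rfl
  | cons e p ih =>
    rw [red_cons, ih h.tail]
    cases p with
    | nil => rfl
    | cons f p => exact if_neg (List.isChain_cons_cons.1 h).1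

/-- If the reduction of `p` starts with `e`, then `rev e` deletes that letter and `e` restores it;
the restored letter does not cancel because the reduction of `p` was reduced. -/
theorem red_cons_rev_cons (e : Γ.E) (p : List Γ.E) : Γ.red (e :: Γ.rev e :: p) = Γ.red p := by
  have h := reduced_red p
  rw [red_cons, red_cons]
  generalize Γ.red p = l at h
  cases l with
  | nil => simp [cancelCons]
  | cons f t =>
    by_cases hf : f = e
    · subst hf
      cases t with
      | nil => simp [cancelCons, Γ.rev_rev]
      | cons g t =>
        have := (List.isChain_cons_cons.1 h).1
        simp [cancelCons, Γ.rev_rev, this]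
    · simp [cancelCons, Γ.rev_rev, hf]

theorem red_rev_cons_cons (e : Γ.E) (p : List Γ.E) : Γ.red (Γ.rev e :: e :: p) = Γ.red p := by
  have := red_cons_rev_cons (Γ.rev e) p
  rwa [Γ.rev_rev] at this

theorem red_append_congr_right (a : List Γ.E) {b c : List Γ.E} (h : Γ.red b = Γ.red c) :
    Γ.red (a ++ b) = Γ.red (a ++ c) := by
  induction a with
  | nil => exact h
  | cons e a ih => rw [List.cons_append, List.cons_append, red_cons, red_cons, ih]

theorem red_red (p : List Γ.E) : Γ.red (Γ.red p) = Γ.red p := (reduced_red p).red_eq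

theorem red_append_red (a b : List Γ.E) : Γ.red (a ++ Γ.red b) = Γ.red (a ++ b) :=
  red_append_congr_right a (red_red b)

theorem red_red_append (a b : List Γ.E) : Γ.red (Γ.red a ++ b) = Γ.red (a ++ b) := by
  induction a with
  | nil => rfl
  | cons e a ih =>
    rw [List.cons_append, red_cons e (a ++ b), ← ih, ← red_cons, red_cons e a]
    cases Γ.red a with
    | nil => rfl
    | cons f t =>
      simp only [cancelCons]
      split
      · subst_vars
        exact (red_cons_rev_cons e _).symm
      · rfl

theorem red_append_congr_left {a b : List Γ.E} (c : List Γ.E) (h : Γ.red a = Γ.red b) :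
    Γ.red (a ++ c) = Γ.red (b ++ c) := by
  rw [← red_red_append, h, red_red_append]

theorem red_backtrack {p q : List Γ.E} (h : Γ.Backtrack p q) : Γ.red p = Γ.red q := by
  obtain ⟨a, b, e, rfl, rfl⟩ := h
  exact red_append_congr_right a (red_cons_rev_cons e b)

theorem length_red_le (p : List Γ.E) : (Γ.red p).length ≤ p.length := by
  induction p with
  | nil => rfl
  | cons e p ih =>
    rw [red_cons]
    cases h : Γ.red p with
    | nil => simp [cancelCons]
    | cons f t =>
      rw [h] at ih
      simp only [cancelCons, List.length_cons] at *
      split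
      · omega
      · simpa using ih

theorem red_inv_append_self (p : List Γ.E) : Γ.red (Γ.inv p ++ p) = [] := by
  induction p with
  | nil => rfl
  | cons e p ih =>
    rw [inv_cons, List.append_assoc]
    exact (red_append_congr_right _ (red_rev_cons_cons e p)).trans ih

theorem red_append_inv_self (p : List Γ.E) : Γ.red (p ++ Γ.inv p) = [] := by
  have := red_inv_append_self (Γ.inv p)
  rwa [inv_inv] at this

theorem red_append_inv_append (p a : List Γ.E) : Γ.red (p ++ (Γ.inv p ++ a)) = Γ.red a := by
  rw [← List.append_assoc, ← red_red_append, red_append_inv_self]; rfl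

theorem red_inv_append_append (p a : List Γ.E) : Γ.red (Γ.inv p ++ (p ++ a)) = Γ.red a := by
  rw [← List.append_assoc, ← red_red_append, red_inv_append_self]; rfl

theorem isPath_append_iff {u w : Γ.V} {p q : List Γ.E} :
    Γ.IsPath u (p ++ q) w ↔ ∃ v, Γ.IsPath u p v ∧ Γ.IsPath v q w := by
  constructor
  · intro h
    induction p generalizing u with
    | nil => exact ⟨u, rfl, h⟩
    | cons e p ih =>
      obtain ⟨v, h1, h2⟩ := ih h.2
      exact ⟨v, ⟨h.1, h1⟩, h2⟩
  · rintro ⟨v, h1, h2⟩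
    exact Γ.isPath_append h1 h2

theorem tgt_rev (e : Γ.E) : Γ.tgt (Γ.rev e) = Γ.src e := by simp [tgt, Γ.rev_rev]

theorem IsPath.red {u v : Γ.V} {p : List Γ.E} (h : Γ.IsPath u p v) : Γ.IsPath u (Γ.red p) v := by
  induction p generalizing u with
  | nil => exact h
  | cons e p ih =>
    have := ih h.2
    rw [red_cons]
    generalize Γ.red p = l at this
    cases l with
    | nil => exact ⟨h.1, this⟩
    | cons f t =>
      simp only [cancelCons]
      split
      · subst_vars
        have h2 := this.2
        rwa [tgt_rev, h.1] at h2
      · exact ⟨h.1, this⟩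

/-- The prefix `r` is carried along because a tail of a closed path is not closed and has no class
of its own; the induction moves edges from `p` to `r`. -/
theorem mk_append_red {u v : Γ.V} (r p : List Γ.E) (hr : Γ.IsPath v r u) (hp : Γ.IsPath u p v) :
    Pi1.mk (⟨r ++ p, Γ.isPath_append hr hp⟩ : Γ.ClosedPath v) =
      Pi1.mk ⟨r ++ Γ.red p, Γ.isPath_append hr hp.red⟩ := by
  induction p generalizing u r with
  | nil => rfl
  | cons e p ih =>
    have h1 := ih (r ++ [e]) (Γ.isPath_append hr ⟨hp.1, rfl⟩) hp.2
    have h2 : Pi1.mk (⟨r ++ e :: Γ.red p, Γ.isPath_append hr ⟨hp.1, hp.2.red⟩⟩ :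
        Γ.ClosedPath v) = Pi1.mk ⟨r ++ Γ.red (e :: p), Γ.isPath_append hr hp.red⟩ := by
      have key : ∀ (l : List Γ.E) (ha : Γ.IsPath v (r ++ e :: l) v)
          (hb : Γ.IsPath v (r ++ cancelCons (fun a b => b = Γ.rev a) e l) v),
          Pi1.mk ⟨r ++ e :: l, ha⟩ =
            Pi1.mk ⟨r ++ cancelCons (fun a b => b = Γ.rev a) e l, hb⟩ := by
        intro l ha hb
        cases l with
        | nil => rfl
        | cons f t =>
          by_cases hf : f = Γ.rev e
          · subst hf
            exact Quot.sound ⟨r, t, e, rfl, by simp [cancelCons]⟩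
          · exact congrArg (Quot.mk _) (Subtype.ext (by simp [cancelCons, hf]))
      exact key _ _ _
    rw [← h2]
    simpa using h1

/-- The reduced closed edge path in a homotopy class. -/
noncomputable def Pi1.nf {v : Γ.V} (γ : Γ.Pi1 v) : List Γ.E :=
  Quot.lift (fun p : Γ.ClosedPath v => Γ.red p.1) (fun _ _ h => red_backtrack h) γ

namespace Pi1

variable {v : Γ.V}

theorem nf_mk {p : List Γ.E} (h : Γ.IsPath v p v) : (mk ⟨p, h⟩ : Γ.Pi1 v).nf = Γ.red p := rfl

theorem isPath_nf (γ : Γ.Pi1 v) : Γ.IsPath v γ.nf v := by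
  obtain ⟨p⟩ := γ
  exact p.2.red

theorem reduced_nf (γ : Γ.Pi1 v) : Γ.Reduced γ.nf := by
  obtain ⟨p⟩ := γ
  exact reduced_red p.1

theorem mk_nf (γ : Γ.Pi1 v) : mk ⟨γ.nf, γ.isPath_nf⟩ = γ := by
  obtain ⟨p⟩ := γ
  exact (mk_append_red [] p.1 rfl p.2).symm

theorem nf_injective : Function.Injective (nf : Γ.Pi1 v → List Γ.E) := by
  intro γ δ h
  rw [← mk_nf γ, ← mk_nf δ]
  simp only [h]

theorem nf_one : (1 : Γ.Pi1 v).nf = [] := rfl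

theorem nf_mul (γ δ : Γ.Pi1 v) : (γ * δ).nf = Γ.red (γ.nf ++ δ.nf) := by
  obtain ⟨p⟩ := γ
  obtain ⟨q⟩ := δ
  change Γ.red (p.1 ++ q.1) = Γ.red (Γ.red p.1 ++ Γ.red q.1)
  rw [red_red_append, red_append_red]

theorem nf_inv (γ : Γ.Pi1 v) : (γ⁻¹).nf = Γ.inv γ.nf := by
  conv_lhs => rw [← mk_nf γ]
  exact γ.reduced_nf.inv.red_eq

end Pi1

theorem Represents.red_eq {v : Γ.V} {γ : Γ.Pi1 v} {p : List Γ.E} (h : Γ.Represents γ p) :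
    Γ.red p = γ.nf := by
  obtain ⟨h, rfl⟩ := h
  rfl

theorem represents_of_red_eq {v : Γ.V} {γ : Γ.Pi1 v} {p : List Γ.E} (hp : Γ.IsPath v p v)
    (h : Γ.red p = γ.nf) : Γ.Represents γ p :=
  ⟨hp, Pi1.nf_injective h⟩

theorem pathLength_eq {v : Γ.V} (γ : Γ.Pi1 v) : Γ.pathLength γ = γ.nf.length := by
  have : {k | ∃ p : List Γ.E, Γ.Represents γ p ∧ Γ.Reduced p ∧ p.length = k} =
      {γ.nf.length} := by
    ext k
    constructor
    · rintro ⟨p, h1, h2, rfl⟩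
      rw [← h1.red_eq, h2.red_eq]; rfl
    · rintro rfl
      exact ⟨γ.nf, represents_of_red_eq γ.isPath_nf γ.reduced_nf.red_eq, γ.reduced_nf, rfl⟩
  rw [pathLength, this, csInf_singleton]

end SerreGraph

/-! ### Cyclically reduced loops and the growth of powers -/

/-- Lengths of k-th powers are controlled up to an error independent of k; this compares their
growth rates. -/
theorem Nat.le_of_forall_mul_le_mul_add {a b C : ℕ} (h : ∀ k, k * a ≤ k * b + C) : a ≤ b := by
  by_contra hab
  have h1 := h (C + 1)
  have h2 : (C + 1) * (b + 1) ≤ (C + 1) * a := Nat.mul_le_mul_left _ (by omega)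
  rw [Nat.mul_add] at h2
  omega

namespace SerreGraph

variable {Γ : SerreGraph}

theorem Reduced.append_singleton_cons {p q : List Γ.E} {e : Γ.E} (h1 : Γ.Reduced (p ++ [e]))
    (h2 : Γ.Reduced (e :: q)) : Γ.Reduced (p ++ e :: q) :=
  List.isChain_split.2 ⟨h1, h2⟩

theorem Reduced.append {p q : List Γ.E} (hp : Γ.Reduced p) (hq : Γ.Reduced q)
    (h : ∀ e ∈ p.getLast?, q.head? ≠ some (Γ.rev e)) : Γ.Reduced (p ++ q) := by
  refine List.isChain_append.2 ⟨hp, hq, fun e he f hf hfe => h e he ?_⟩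
  rw [← hfe]
  exact hf

theorem Reduced.flatten_replicate {p : List Γ.E} (h : Γ.Reduced (p ++ p)) (k : ℕ) :
    Γ.Reduced (List.replicate k p).flatten := by
  by_cases hp : p = []
  · subst hp
    simpa using Reduced.nil
  induction k with
  | zero => exact Reduced.nil
  | succ k ih =>
    cases k with
    | zero => simpa using h.left
    | succ k =>
      simp only [List.replicate_succ, List.flatten_cons] at ih ⊢
      rw [← List.append_assoc]
      exact List.IsChain.append_overlap h ih hp

theorem Reduced.exists_eq_of_not_reduced_append_self {p : List Γ.E} (h : Γ.Reduced p)
    (h' : ¬ Γ.Reduced (p ++ p)) : ∃ e m, p = e :: (m ++ [Γ.rev e]) := by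
  have h1 : ∃ e ∈ p.getLast?, p.head? = some (Γ.rev e) := by
    by_contra! h2
    exact h' (h.append h h2)
  obtain ⟨e, he, hh⟩ := h1
  obtain ⟨t, rfl⟩ := List.head?_eq_some_iff.1 hh
  rcases List.eq_nil_or_concat t with rfl | ⟨m, f, rfl⟩
  -- A single edge would have to be its own reverse.
  · simp only [List.getLast?_singleton, Option.mem_def, Option.some.injEq] at he
    exact absurd he (Γ.rev_ne e)
  · refine ⟨Γ.rev e, m, ?_⟩
    have hf : f = e := by simpa [List.getLast?_cons] using he
    rw [Γ.rev_rev, hf, List.concat_eq_append]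

theorem red_conj_append (q a b : List Γ.E) :
    Γ.red ((q ++ a ++ Γ.inv q) ++ (q ++ b ++ Γ.inv q)) = Γ.red (q ++ (a ++ b) ++ Γ.inv q) := by
  simp only [List.append_assoc]
  refine red_append_congr_right _ (red_append_congr_right _ ?_)
  exact red_inv_append_append _ _

theorem Represents.nf_pow {v : Γ.V} {γ : Γ.Pi1 v} {q p : List Γ.E}
    (h : Γ.Represents γ (q ++ p ++ Γ.inv q)) (k : ℕ) :
    (γ ^ k).nf = Γ.red (q ++ (List.replicate k p).flatten ++ Γ.inv q) := by
  induction k with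
  | zero => simp [Pi1.nf_one, red_append_inv_self]
  | succ k ih =>
    rw [pow_succ', Pi1.nf_mul, ih, ← h.red_eq, red_red_append, red_append_red, red_conj_append]
    rfl

/-- The k-fold repetition of `p` is already reduced, and conjugating by `q`, in either direction,
adds at most twice the length of `q`. -/
theorem Represents.length_nf_pow {v : Γ.V} {γ : Γ.Pi1 v} {q p : List Γ.E}
    (h : Γ.Represents γ (q ++ p ++ Γ.inv q)) (hp : Γ.Reduced (p ++ p)) (k : ℕ) :
    (γ ^ k).nf.length ≤ k * p.length + 2 * q.length ∧
      k * p.length ≤ (γ ^ k).nf.length + 2 * q.length := by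
  rw [h.nf_pow k]
  constructor
  · refine (length_red_le _).trans ?_
    simp
    omega
  · have h1 : Γ.red (Γ.inv q ++ (Γ.red (q ++ (List.replicate k p).flatten ++ Γ.inv q) ++ q)) =
        (List.replicate k p).flatten := by
      rw [← red_append_red, red_red_append, red_append_red]
      simp only [List.append_assoc]
      rw [red_inv_append_append, ← red_append_red, red_inv_append_self, List.append_nil,
        (hp.flatten_replicate k).red_eq]
    have h2 := congrArg List.length h1
    have h3 := length_red_le
      (Γ.inv q ++ (Γ.red (q ++ (List.replicate k p).flatten ++ Γ.inv q) ++ q))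
    rw [h2] at h3
    simp only [List.length_append, length_inv, List.length_flatten, List.map_replicate,
      List.sum_replicate, smul_eq_mul] at h3
    omega

/-- A reduced closed path that is not cyclically reduced begins with some `e` and ends with its
reverse. Strip both, append `e` to the conjugating path and repeat on the shorter middle part. -/
theorem Reduced.exists_conj_cyclicallyReduced : ∀ {p : List Γ.E} {u : Γ.V}, Γ.Reduced p →
    Γ.IsPath u p u → ∃ w q r, Γ.IsPath u q w ∧ Γ.IsPath w r w ∧ Γ.Reduced (r ++ r) ∧
      Γ.red (q ++ r ++ Γ.inv q) = p := by
  suffices H : ∀ (k : ℕ) (p : List Γ.E) (u : Γ.V), p.length ≤ k → Γ.Reduced p →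
      Γ.IsPath u p u → ∃ w q r, Γ.IsPath u q w ∧ Γ.IsPath w r w ∧ Γ.Reduced (r ++ r) ∧
      Γ.red (q ++ r ++ Γ.inv q) = p from fun {p u} => H p.length p u le_rfl
  intro k
  induction k with
  | zero =>
    intro p u hk hp hu
    have : p = [] := List.length_eq_zero_iff.1 (by omega)
    subst this
    exact ⟨u, [], [], rfl, rfl, Reduced.nil, rfl⟩
  | succ k ih =>
    intro p u hk hp hu
    by_cases hpp : Γ.Reduced (p ++ p)
    · exact ⟨u, [], p, rfl, hu, hpp, by simpa using hp.red_eq⟩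
    obtain ⟨e, m, rfl⟩ := hp.exists_eq_of_not_reduced_append_self hpp
    obtain ⟨h1, h2⟩ := hu
    obtain ⟨x, h3, h4⟩ := isPath_append_iff.1 h2
    have hx : x = Γ.tgt e := h4.1.symm
    subst hx
    obtain ⟨w, q, r, hq, hr, hrr, he⟩ := ih m (Γ.tgt e)
      (by simp only [List.length_cons, List.length_append, List.length_nil] at hk; omega)
      hp.tail.left h3
    refine ⟨w, e :: q, r, ⟨h1, hq⟩, hr, hrr, ?_⟩
    have h5 : Γ.red (e :: (Γ.red (q ++ r ++ Γ.inv q) ++ [Γ.rev e])) =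
        Γ.red (e :: q ++ r ++ Γ.inv (e :: q)) := by
      rw [red_cons, red_red_append, ← red_cons, inv_cons]
      simp
    rw [← h5, he, hp.red_eq]

theorem Pi1.exists_represents_cyclicallyReduced {v : Γ.V} (γ : Γ.Pi1 v) :
    ∃ u q p, Γ.IsPath v q u ∧ Γ.IsPath u p u ∧ Γ.Reduced (p ++ p) ∧
      Γ.Represents γ (q ++ p ++ Γ.inv q) := by
  obtain ⟨w, q, r, hq, hr, hrr, he⟩ := γ.reduced_nf.exists_conj_cyclicallyReduced γ.isPath_nf
  exact ⟨w, q, r, hq, hr, hrr, represents_of_red_eq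
    (Γ.isPath_append (Γ.isPath_append hq hr) (Γ.isPath_inv hq)) he⟩

/-- One conjugator serves all powers, so the error is twice its length. -/
theorem Pi1.exists_length_nf_pow_le {v : Γ.V} {γ δ : Γ.Pi1 v}
    (h : ConjClasses.mk γ = ConjClasses.mk δ) :
    ∃ C, ∀ k : ℕ, (γ ^ k).nf.length ≤ (δ ^ k).nf.length + C := by
  obtain ⟨c, hc⟩ := isConj_iff.1 (ConjClasses.mk_eq_mk_iff_isConj.1 h.symm)
  refine ⟨2 * c.nf.length, fun k => ?_⟩
  rw [← hc, conj_pow, Pi1.nf_mul, Pi1.nf_mul, Pi1.nf_inv, red_red_append]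
  refine (length_red_le _).trans ?_
  simp
  omega

/-- Two cyclically reduced representatives have the same length, because both lengths are the growth
rate of the powers. So the set whose infimum defines the loop length is a singleton. -/
theorem loopLength_eq {v u : Γ.V} {q p : List Γ.E} {γ : Γ.Pi1 v} (hq : Γ.IsPath v q u)
    (hp : Γ.IsPath u p u) (hpp : Γ.Reduced (p ++ p)) (h : Γ.Represents γ (q ++ p ++ Γ.inv q)) :
    Γ.loopLength (ConjClasses.mk γ) = p.length := by
  have key : ∀ {q p q' p' : List Γ.E} {γ γ' : Γ.Pi1 v}, Γ.Reduced (p ++ p) →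
      Γ.Represents γ (q ++ p ++ Γ.inv q) → Γ.Reduced (p' ++ p') →
      Γ.Represents γ' (q' ++ p' ++ Γ.inv q') → ConjClasses.mk γ = ConjClasses.mk γ' →
      p.length ≤ p'.length := by
    intro q p q' p' γ γ' hp h hp' h' hc
    obtain ⟨C, hC⟩ := Pi1.exists_length_nf_pow_le hc
    refine Nat.le_of_forall_mul_le_mul_add (C := 2 * q.length + 2 * q'.length + C) fun k => ?_
    have h1 := (h.length_nf_pow hp k).2
    have h2 := (h'.length_nf_pow hp' k).1
    have h3 := hC k
    omega
  have : {k | ∃ (u : Γ.V) (q p : List Γ.E) (δ : Γ.Pi1 v),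
      Γ.IsPath v q u ∧ Γ.IsPath u p u ∧ Γ.Reduced (p ++ p) ∧
      Γ.Represents δ (q ++ p ++ Γ.inv q) ∧ ConjClasses.mk δ = ConjClasses.mk γ ∧
      p.length = k} = {p.length} := by
    ext k
    constructor
    · rintro ⟨u', q', p', δ, -, -, h3, h4, h5, rfl⟩
      exact le_antisymm (key h3 h4 hpp h h5) (key hpp h h3 h4 h5.symm)
    · rintro rfl
      exact ⟨u, q, p, γ, hq, hp, hpp, h, rfl, rfl⟩
  rw [loopLength, this, csInf_singleton]

/-- The loop length is the stable length of the reduced paths of the powers. -/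
theorem exists_length_nf_pow_loopLength {v : Γ.V} (γ : Γ.Pi1 v) :
    ∃ C, ∀ k : ℕ, (γ ^ k).nf.length ≤ k * Γ.loopLength (ConjClasses.mk γ) + C ∧
      k * Γ.loopLength (ConjClasses.mk γ) ≤ (γ ^ k).nf.length + C := by
  obtain ⟨u, q, p, hq, hp, hpp, h⟩ := γ.exists_represents_cyclicallyReduced
  rw [loopLength_eq hq hp hpp h]
  exact ⟨_, h.length_nf_pow hpp⟩

end SerreGraph

/-! ### Based length functions and their finiteness -/

open SerreGraph

/-- The word in the symbols `(i, k, b)`, standing for the `k`th letter of the `i`th generator or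
its inverse, which spells `α` if the `i`th generator has length `l i`. -/
def symbolWord {n B : ℕ} (l : Fin n → Fin (B + 1)) (α : FreeGroup (Fin n)) :
    List (Fin n × Fin B × Bool) :=
  α.toWord.flatMap fun x =>
    if x.2 then ((List.finRange B).take (l x.1)).map fun k => (x.1, k, true)
    else (((List.finRange B).take (l x.1)).map fun k => (x.1, k, false)).reverse

namespace SerreGraph

variable {Γ : SerreGraph}

/-- The value of a symbol, if the generators are spelled by the paths `u i`. -/
def symbolValue {n B : ℕ} (u : Fin n → List Γ.E) (x : Fin n × Fin B × Bool) : Option Γ.E :=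
  if x.2.2 then (u x.1)[x.2.1]? else ((u x.1)[x.2.1]?).map Γ.rev

theorem map_symbolValue {n B : ℕ} (u : Fin n → List Γ.E) (l : Fin n → Fin (B + 1))
    (h : ∀ i, (u i).length = l i) (α : FreeGroup (Fin n)) :
    (symbolWord l α).map (symbolValue u) =
      (α.toWord.flatMap fun x => if x.2 then u x.1 else Γ.inv (u x.1)).map some := by
  have key : ∀ i, ((List.finRange B).take (l i)).map (fun k : Fin B => (u i)[k]?) =
      (u i).map some := by
    intro i
    have := (l i).2
    refine List.ext_getElem (by simp [h]; omega) fun k h1 h2 => ?_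
    simp only [List.length_map] at h2
    simp [h2]
  rw [symbolWord, List.map_flatMap, List.map_flatMap]
  refine congrArg (fun f => List.flatMap f α.toWord) (funext ?_)
  rintro ⟨i, b⟩
  cases b
  · simp only [Bool.false_eq_true, if_false, List.map_reverse, inv, List.map_map]
    refine congrArg List.reverse ?_
    have := congrArg (List.map (Option.map Γ.rev)) (key i)
    simp only [List.map_map] at this
    exact this
  · simp only [if_true, List.map_map]
    exact key i

end SerreGraph

namespace PointedMarkedGraph

variable {n : ℕ} (σ : PointedMarkedGraph n)

/-- The reduced path which spells `α` after the base point is moved along the path `q`. -/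
noncomputable def basedWord (q : List σ.graph.E) (α : FreeGroup (Fin n)) : List σ.graph.E :=
  σ.graph.red (σ.graph.inv q ++ (σ.marking α).nf ++ q)

variable {σ}

theorem reduced_basedWord (q : List σ.graph.E) (α : FreeGroup (Fin n)) :
    σ.graph.Reduced (σ.basedWord q α) := reduced_red _

theorem isPath_basedWord {q : List σ.graph.E} {v : σ.graph.V} (hq : σ.graph.IsPath σ.base q v)
    (α : FreeGroup (Fin n)) : σ.graph.IsPath v (σ.basedWord q α) v :=
  (σ.graph.isPath_append (σ.graph.isPath_append (σ.graph.isPath_inv hq) (Pi1.isPath_nf _))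
    hq).red

theorem basedWord_nil (α : FreeGroup (Fin n)) : σ.basedWord [] α = (σ.marking α).nf := by
  simpa [basedWord] using (Pi1.reduced_nf _).red_eq

theorem basedWord_one (q : List σ.graph.E) : σ.basedWord q 1 = [] := by
  simp [basedWord, Pi1.nf_one, red_inv_append_self]

theorem basedWord_mul (q : List σ.graph.E) (α β : FreeGroup (Fin n)) :
    σ.basedWord q (α * β) = σ.graph.red (σ.basedWord q α ++ σ.basedWord q β) := by
  have h := red_conj_append (σ.graph.inv q) (σ.marking α).nf (σ.marking β).nf
  rw [SerreGraph.inv_inv] at h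
  rw [basedWord, basedWord, basedWord, red_red_append, red_append_red, h, map_mul, Pi1.nf_mul]
  exact red_append_congr_left _ (red_append_red _ _)

theorem red_inv_red {Γ : SerreGraph} (p : List Γ.E) : Γ.inv (Γ.red p) = Γ.red (Γ.inv p) := by
  have h1 : Γ.red (Γ.inv p ++ (p ++ Γ.inv (Γ.red p))) = Γ.red (Γ.inv p) := by
    have h2 : Γ.red (p ++ Γ.inv (Γ.red p)) = Γ.red [] := by
      rw [← red_red_append, red_append_inv_self]; rfl
    rw [red_append_congr_right _ h2, List.append_nil]
  rw [red_inv_append_append, (reduced_red p).inv.red_eq] at h1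
  exact h1

theorem basedWord_inv (q : List σ.graph.E) (α : FreeGroup (Fin n)) :
    σ.basedWord q α⁻¹ = σ.graph.inv (σ.basedWord q α) := by
  rw [basedWord, basedWord, red_inv_red, map_inv, Pi1.nf_inv, inv_append, inv_append,
    SerreGraph.inv_inv, List.append_assoc]

theorem basedWord_append_singleton (q : List σ.graph.E) (e : σ.graph.E)
    (α : FreeGroup (Fin n)) :
    σ.basedWord (q ++ [e]) α = σ.graph.red (σ.graph.rev e :: (σ.basedWord q α ++ [e])) := by
  rw [red_cons, basedWord, basedWord, red_red_append, ← red_cons]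
  simp [inv]

theorem red_append_basedWord (q : List σ.graph.E) (α : FreeGroup (Fin n)) :
    σ.graph.red (q ++ σ.basedWord q α ++ σ.graph.inv q) = (σ.marking α).nf := by
  rw [List.append_assoc, basedWord,
    red_append_congr_right _ (red_red_append _ _)]
  simp only [List.append_assoc]
  rw [red_append_inv_append, ← red_append_red, red_append_inv_self, List.append_nil]
  exact (Pi1.reduced_nf _).red_eq

theorem represents_basedWord {q : List σ.graph.E} {v : σ.graph.V}
    (hq : σ.graph.IsPath σ.base q v) (α : FreeGroup (Fin n)) :
    σ.graph.Represents (σ.marking α) (q ++ σ.basedWord q α ++ σ.graph.inv q) :=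
  represents_of_red_eq (σ.graph.isPath_append (σ.graph.isPath_append hq (isPath_basedWord hq α))
    (σ.graph.isPath_inv hq)) (red_append_basedWord q α)

theorem length_basedWord_le (q : List σ.graph.E) (α : FreeGroup (Fin n)) :
    (σ.basedWord q α).length ≤ (σ.marking α).nf.length + 2 * q.length := by
  refine (length_red_le _).trans ?_
  simp
  omega

theorem length_nf_marking_le (q : List σ.graph.E) (α : FreeGroup (Fin n)) :
    (σ.marking α).nf.length ≤ (σ.basedWord q α).length + 2 * q.length := by
  rw [← red_append_basedWord q α]
  refine (length_red_le _).trans ?_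
  simp
  omega

theorem basedWord_eq_red_flatMap (q : List σ.graph.E) (α : FreeGroup (Fin n)) :
    σ.basedWord q α = σ.graph.red (α.toWord.flatMap fun x =>
      if x.2 then σ.basedWord q (FreeGroup.of x.1)
      else σ.graph.inv (σ.basedWord q (FreeGroup.of x.1))) := by
  have key : ∀ L : List (Fin n × Bool), σ.basedWord q (FreeGroup.mk L) =
      σ.graph.red (L.flatMap fun x => if x.2 then σ.basedWord q (FreeGroup.of x.1)
        else σ.graph.inv (σ.basedWord q (FreeGroup.of x.1))) := by
    intro L
    induction L with
    | nil => exact basedWord_one q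
    | cons x L ih =>
      have h : FreeGroup.mk (x :: L) = FreeGroup.mk [x] * FreeGroup.mk L := rfl
      rw [h, basedWord_mul, ih, red_append_red, List.flatMap_cons]
      obtain ⟨i, b⟩ := x
      refine red_append_congr_left _ (congrArg _ ?_)
      cases b
      · exact basedWord_inv q (FreeGroup.of i)
      · rfl
  rw [← key, FreeGroup.mk_toWord]

/-- There are only finitely many based length functions that are bounded by a given number on
the generators. -/
theorem finite_setOf_length_basedWord (n B : ℕ) :
    {F : FreeGroup (Fin n) → ℕ | ∃ (σ : PointedMarkedGraph n) (q : List σ.graph.E),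
      (∀ i, (σ.basedWord q (FreeGroup.of i)).length ≤ B) ∧
      F = fun α => (σ.basedWord q α).length}.Finite := by
  -- The finite code of a length function: the lengths of the generators, and the relation saying
  -- which symbols cancel.
  refine (Set.finite_range (fun x : (Fin n → Fin (B + 1)) ×
    (Fin n × Fin B × Bool → Fin n × Fin B × Bool → Prop) => fun α : FreeGroup (Fin n) =>
      (freeReduce x.2 (symbolWord x.1 α)).length)).subset ?_
  rintro F ⟨σ, q, hB, rfl⟩
  set u : Fin n → List σ.graph.E := fun i => σ.basedWord q (FreeGroup.of i) with hu
  refine ⟨(fun i => ⟨(u i).length, Nat.lt_succ_of_le (hB i)⟩,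
    fun x y => symbolValue u y = (symbolValue u x).map σ.graph.rev), funext fun α => ?_⟩
  dsimp only
  -- Symbols and edges are compared inside `Option` of the edges: the reduction is transported there
  -- along `symbolValue` from one side and along `some` from the other.
  have h1 := freeReduce_map (S := fun x y : Option σ.graph.E => y = x.map σ.graph.rev)
    (symbolValue u) (fun x y => Iff.rfl)
    (symbolWord (fun i => (⟨(u i).length, Nat.lt_succ_of_le (hB i)⟩ : Fin (B + 1))) α)
  rw [map_symbolValue u _ (fun i => rfl) α, freeReduce_map
    (R := fun x y : σ.graph.E => y = σ.graph.rev x) some (fun x y => by simp)] at h1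
  have h2 := congrArg List.length h1
  rw [List.length_map, List.length_map] at h2
  rw [← h2, basedWord_eq_red_flatMap]
  rfl

/-- Changing the base point alters all lengths by a bounded amount, so equal based length functions
give equal growth of powers. -/
theorem loopLength_le_of_length_basedWord {σ τ : PointedMarkedGraph n} {q : List σ.graph.E}
    {r : List τ.graph.E} (h : ∀ α, (σ.basedWord q α).length = (τ.basedWord r α).length)
    (α : FreeGroup (Fin n)) :
    σ.graph.loopLength (ConjClasses.mk (σ.marking α)) ≤
      τ.graph.loopLength (ConjClasses.mk (τ.marking α)) := by
  obtain ⟨C, hC⟩ := exists_length_nf_pow_loopLength (σ.marking α)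
  obtain ⟨D, hD⟩ := exists_length_nf_pow_loopLength (τ.marking α)
  refine Nat.le_of_forall_mul_le_mul_add (C := C + D + 2 * q.length + 2 * r.length) fun k => ?_
  have h1 := (hC k).2
  have h2 := (hD k).1
  have h3 := length_nf_marking_le q (α ^ k)
  have h4 := length_basedWord_le r (α ^ k)
  have h5 := h (α ^ k)
  rw [map_pow] at h3 h4
  omega

theorem loopLength_eq_length_basedWord {q : List σ.graph.E} {v : σ.graph.V}
    (hq : σ.graph.IsPath σ.base q v) {α : FreeGroup (Fin n)}
    (h : σ.graph.Reduced (σ.basedWord q α ++ σ.basedWord q α)) :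
    σ.graph.loopLength (ConjClasses.mk (σ.marking α)) = (σ.basedWord q α).length :=
  loopLength_eq hq (isPath_basedWord hq α) h (represents_basedWord hq α)

/-- If the loops of the generators and their pairwise products have bounded length, then some
base point has the generators of bounded based length. -/
theorem exists_length_basedWord_le {B : ℕ}
    (h1 : ∀ i, σ.graph.loopLength (ConjClasses.mk (σ.marking (FreeGroup.of i))) ≤ B)
    (h2 : ∀ i j, σ.graph.loopLength
      (ConjClasses.mk (σ.marking (FreeGroup.of i * FreeGroup.of j))) ≤ B) :
    ∃ q : List σ.graph.E, ∀ i, (σ.basedWord q (FreeGroup.of i)).length ≤ B := by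
  -- Choose the base point to minimise the total length of the generators. A generator longer than
  -- `B` is not cyclically reduced there, and moving the base point along its first edge will lower
  -- the total.
  let S : Set ℕ := {s | ∃ q v, σ.graph.IsPath σ.base q v ∧
    ∑ i, (σ.basedWord q (FreeGroup.of i)).length = s}
  have hS : S.Nonempty := ⟨_, [], σ.base, rfl, rfl⟩
  obtain ⟨q, v, hq, hs⟩ := Nat.sInf_mem hS
  refine ⟨q, fun i => ?_⟩
  by_contra! hi
  have hri : ¬ σ.graph.Reduced
      (σ.basedWord q (FreeGroup.of i) ++ σ.basedWord q (FreeGroup.of i)) := by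
    intro h
    have := loopLength_eq_length_basedWord hq h
    have := h1 i
    omega
  obtain ⟨e, m, hem⟩ :=
    (reduced_basedWord q (FreeGroup.of i)).exists_eq_of_not_reduced_append_self hri
  have hpi := isPath_basedWord hq (FreeGroup.of i)
  rw [hem] at hpi
  have hqe : σ.graph.IsPath σ.base (q ++ [e]) (σ.graph.tgt e) :=
    σ.graph.isPath_append hq ⟨hpi.1, rfl⟩
  -- The move prepends `rev e` and appends `e`. No word gets longer if it is empty, starts with `e`
  -- or ends with `rev e`; every generator will be of one of these kinds.
  have hdec : ∀ j, (σ.basedWord (q ++ [e]) (FreeGroup.of j)).length ≤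
      (σ.basedWord q (FreeGroup.of j)).length := by
    intro j
    rw [basedWord_append_singleton]
    by_cases hj : σ.basedWord q (FreeGroup.of j) = []
    · rw [hj]
      simp [red_rev_cons_cons]
    by_cases hh : (σ.basedWord q (FreeGroup.of j)).head? = some e
    · obtain ⟨t, ht⟩ := List.head?_eq_some_iff.1 hh
      rw [ht, List.cons_append, red_rev_cons_cons]
      refine (length_red_le _).trans ?_
      simp
    by_cases hl : (σ.basedWord q (FreeGroup.of j)).getLast? = some (σ.graph.rev e)
    · obtain ⟨t, ht⟩ := List.getLast?_eq_some_iff.1 hl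
      have h3 : σ.graph.red (t ++ [σ.graph.rev e] ++ [e]) = σ.graph.red t := by
        rw [List.append_assoc]
        have := red_append_congr_right t (red_rev_cons_cons e [])
        rwa [List.append_nil] at this
      rw [ht, red_cons, h3, ← red_cons]
      refine (length_red_le _).trans ?_
      simp
    -- Otherwise nothing cancels between the words of generators `i` and `j` in either order. Their
    -- product is then cyclically reduced and longer than `B`, against `h2`.
    · exfalso
      have hu := reduced_basedWord q (FreeGroup.of i)
      have hw := reduced_basedWord q (FreeGroup.of j)
      have hlast : (σ.basedWord q (FreeGroup.of i)).getLast? = some (σ.graph.rev e) := by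
        rw [hem]; simp [List.getLast?_cons]
      have hhead : (σ.basedWord q (FreeGroup.of i)).head? = some e := by
        rw [hem]; rfl
      have h3 : σ.graph.Reduced
          (σ.basedWord q (FreeGroup.of i) ++ σ.basedWord q (FreeGroup.of j)) := by
        refine hu.append hw fun f hf => ?_
        rw [hlast] at hf
        rw [← Option.some.inj hf, σ.graph.rev_rev]
        exact hh
      have h4 : σ.graph.Reduced
          (σ.basedWord q (FreeGroup.of j) ++ σ.basedWord q (FreeGroup.of i)) := by
        refine hw.append hu fun f hf hf' => ?_
        rw [hhead] at hf'
        rw [Option.some.inj hf', σ.graph.rev_rev] at hl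
        exact hl hf
      have h5 : σ.basedWord q (FreeGroup.of i * FreeGroup.of j) =
          σ.basedWord q (FreeGroup.of i) ++ σ.basedWord q (FreeGroup.of j) := by
        rw [basedWord_mul, h3.red_eq]
      have h6 : σ.graph.Reduced (σ.basedWord q (FreeGroup.of i * FreeGroup.of j) ++
          σ.basedWord q (FreeGroup.of i * FreeGroup.of j)) := by
        rw [h5]
        have h7 := List.IsChain.append_overlap h4 h3 (by rw [hem]; simp)
        rw [List.append_assoc] at h7
        have h8 := List.IsChain.append_overlap h3 h7 hj
        exact h8
      have h7 := loopLength_eq_length_basedWord hq h6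
      have h8 := h2 i j
      rw [h7, h5, List.length_append] at h8
      omega
  have hlt : ∑ j, (σ.basedWord (q ++ [e]) (FreeGroup.of j)).length <
      ∑ j, (σ.basedWord q (FreeGroup.of j)).length := by
    -- The word of generator `i` loses an edge at both ends, so the decrease is strict.
    refine Finset.sum_lt_sum (fun j _ => hdec j) ⟨i, Finset.mem_univ i, ?_⟩
    rw [basedWord_append_singleton, hem, List.cons_append, red_rev_cons_cons, List.append_assoc]
    have h3 : σ.graph.red (m ++ ([σ.graph.rev e] ++ [e])) = σ.graph.red m := by
      have := red_append_congr_right m (red_rev_cons_cons e [])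
      rwa [List.append_nil] at this
    rw [h3]
    refine (Nat.lt_succ_of_le (length_red_le _)).trans ?_
    simp
  rw [hs] at hlt
  exact absurd hlt (not_lt.2 (Nat.sInf_le ⟨_, _, hqe, rfl⟩))

end PointedMarkedGraph

/-! ### Finiteness and lexicographic minima -/

/-- A relation replaces a map because a norm is computed from a chosen graph and base point,
although it depends only on the length function. -/
theorem Set.Finite.of_functional {α β : Type*} {s : Set α} (hs : s.Finite) {t : Set β}
    (R : α → β → Prop) (h : ∀ b ∈ t, ∃ a ∈ s, R a b)
    (hR : ∀ a b b', R a b → R a b' → b = b') : t.Finite := by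
  rcases t.eq_empty_or_nonempty with rfl | ⟨b₀, hb₀⟩
  · exact Set.finite_empty
  have : Nonempty α := ⟨(h b₀ hb₀).choose⟩
  choose! f hf hfR using h
  exact Set.Finite.of_injOn hf
    (fun b hb b' hb' he => hR (f b) b b' (hfR b hb) (he ▸ hfR b' hb')) hs

/-- A nonempty set of sequences of nonnegative integers has a lexicographically least element, if
finitely many of its members are bounded in certain finitely many coordinates. -/
theorem exists_forall_toLex_le {S : Set (ℕ → ℤ)} (hS : S.Nonempty) (h0 : ∀ f ∈ S, ∀ i, 0 ≤ f i)
    (I : Finset ℕ) (hI : ∀ B : ℤ, {f ∈ S | ∀ i ∈ I, f i ≤ B}.Finite) :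
    ∃ m ∈ S, ∀ f ∈ S, toLex m ≤ toLex f := by
  have key : ∀ N : ℕ, ∃ m ∈ S, ∀ f ∈ S, (∀ i < N, m i = f i) ∨ toLex m < toLex f := by
    intro N
    induction N with
    | zero =>
      obtain ⟨m, hm⟩ := hS
      exact ⟨m, hm, fun f _ => Or.inl fun i hi => absurd hi (Nat.not_lt_zero i)⟩
    | succ N ih =>
      obtain ⟨m, hm, hmin⟩ := ih
      -- Among the members agreeing with the current minimiser below `N`, minimise the coordinate
      -- `N`.
      let T : Set ℕ := {k | ∃ f ∈ S, (∀ i < N, m i = f i) ∧ f N = k}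
      have hT : T.Nonempty := ⟨(m N).toNat, m, hm, fun _ _ => rfl, by
        rw [Int.toNat_of_nonneg (h0 m hm N)]⟩
      obtain ⟨g, hg, hgm, hgN⟩ := Nat.sInf_mem hT
      refine ⟨g, hg, fun f hf => ?_⟩
      by_cases h : ∀ i < N, m i = f i
      · have h1 : sInf T ≤ (f N).toNat := Nat.sInf_le ⟨f, hf, h, by
          rw [Int.toNat_of_nonneg (h0 f hf N)]⟩
        have h2 : g N ≤ f N := by
          rw [hgN, ← Int.toNat_of_nonneg (h0 f hf N)]
          exact_mod_cast h1
        rcases h2.eq_or_lt with h3 | h3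
        · refine Or.inl fun i hi => ?_
          rcases Nat.lt_succ_iff_lt_or_eq.1 hi with hi | rfl
          · rw [← hgm i hi, h i hi]
          · exact h3
        · exact Or.inr ⟨N, fun i hi => (hgm i hi).symm.trans (h i hi), h3⟩
      · obtain ⟨j, hj, hlt⟩ := (hmin f hf).resolve_left h
        have hjN : j < N := by
          by_contra hjN
          exact h fun i hi => hj i (lt_of_lt_of_le hi (not_lt.1 hjN))
        refine Or.inr ⟨j, fun i hi => (hgm i (hi.trans hjN)).symm.trans (hj i hi), ?_⟩
        dsimp only [Pi.toLex_apply] at hlt ⊢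
        rwa [← hgm j hjN]
  obtain ⟨N, hN⟩ : ∃ N, ∀ i ∈ I, i < N :=
    ⟨I.sup id + 1, fun i hi => Nat.lt_succ_of_le (Finset.le_sup (f := id) hi)⟩
  obtain ⟨m, hm, hmin⟩ := key N
  have hfin : {f ∈ S | ∀ i ∈ I, m i = f i}.Finite := by
    -- The coordinates of `m` on `I` are nonnegative, so their sum bounds each of them.
    refine (hI (∑ i ∈ I, m i)).subset fun f hf => ⟨hf.1, fun i hi => ?_⟩
    rw [← hf.2 i hi]
    exact Finset.single_le_sum (fun i _ => h0 m hm i) hi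
  obtain ⟨g, hg, hgmin⟩ := Set.exists_min_image _ (toLex : (ℕ → ℤ) → Lex (ℕ → ℤ)) hfin
    ⟨m, hm, fun _ _ => rfl⟩
  refine ⟨g, hg.1, fun f hf => ?_⟩
  rcases hmin f hf with h | h
  · exact hgmin f ⟨hf, fun i hi => h i (hN i hi)⟩
  · exact (hgmin m ⟨hm, fun _ _ => rfl⟩).trans h.le

/-! ### Norms as multiples of length functions; graphs of least norm -/

namespace PointedMarkedGGraph

variable {n : ℕ} {G : Subgroup (MulAut (FreeGroup (Fin n)))}

/-- The action realises `x` by a graph automorphism, and these preserve path length. -/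
theorem pathLength_marking_apply (σ : PointedMarkedGGraph G) (x : G) (α : FreeGroup (Fin n)) :
    σ.graph.pathLength (σ.marking ((x : MulAut (FreeGroup (Fin n))) α)) =
      σ.graph.pathLength (σ.marking α) := by
  rw [← σ.act_marking, Iso.pathLength_map]

theorem loopLength_marking_apply (σ : PointedMarkedGGraph G) (x : G) (α : FreeGroup (Fin n)) :
    σ.graph.loopLength (ConjClasses.mk (σ.marking ((x : MulAut (FreeGroup (Fin n))) α))) =
      σ.graph.loopLength (ConjClasses.mk (σ.marking α)) := by
  rw [← σ.act_marking]
  exact Iso.loopLength_map _ (σ.act_base x) (ConjClasses.mk (σ.marking α))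

variable [Fintype G]

theorem autNorm_apply (a : ℕ → FreeGroup (Fin n)) (σ : PointedMarkedGGraph G) (i : ℕ) :
    ofLex (σ.autNorm a) i = Fintype.card G * (σ.graph.pathLength (σ.marking (a i)) : ℤ) := by
  simp [autNorm, pathLength_marking_apply]

theorem outNorm_apply {w : ℕ → ConjClasses (FreeGroup (Fin n))} (σ : PointedMarkedGGraph G)
    {i : ℕ} {α : FreeGroup (Fin n)} (h : w i = ConjClasses.mk α) :
    ofLex (σ.outNorm w) i =
      Fintype.card G * (σ.graph.loopLength (ConjClasses.mk (σ.marking α)) : ℤ) := by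
  have h1 : ∀ x : G, (σ.graph.loopLength (ConjClasses.map σ.marking.toMonoidHom
      (ConjClasses.map (x : MulAut (FreeGroup (Fin n))).toMonoidHom (w i))) : ℤ) =
      σ.graph.loopLength (ConjClasses.mk (σ.marking α)) := by
    intro x
    rw [h, ← loopLength_marking_apply σ x]
    rfl
  exact (Finset.sum_congr rfl fun x _ => h1 x).trans (by simp)

theorem natCast_le_of_card_mul_le {k : ℕ} {B : ℤ} (h : (Fintype.card G : ℤ) * k ≤ B) :
    k ≤ B.toNat := by
  have h1 : (1 : ℤ) ≤ Fintype.card G := by exact_mod_cast Fintype.card_pos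
  have h2 : (k : ℤ) ≤ Fintype.card G * k := le_mul_of_one_le_left (by positivity) h1
  omega

/-- The controlling coordinates are those of the generators and of the products of two generators,
which are what `exists_length_basedWord_le` needs. -/
theorem finite_outNorm {w : ℕ → ConjClasses (FreeGroup (Fin n))} (hw : Function.Surjective w) :
    ∃ I : Finset ℕ, ∀ B : ℤ, {f : ℕ → ℤ | (∃ σ : PointedMarkedGGraph G, ofLex (σ.outNorm w) = f) ∧
      ∀ i ∈ I, f i ≤ B}.Finite := by
  classical
  choose u hu using hw
  refine ⟨(Finset.univ.image fun i => u (ConjClasses.mk (FreeGroup.of i))) ∪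
    (Finset.univ.image fun x : Fin n × Fin n =>
      u (ConjClasses.mk (FreeGroup.of x.1 * FreeGroup.of x.2))), fun B => ?_⟩
  refine (PointedMarkedGraph.finite_setOf_length_basedWord n B.toNat).of_functional
    (fun F f => ∃ (σ : PointedMarkedGGraph G) (q : List σ.graph.E),
      (F = fun α => (σ.basedWord q α).length) ∧ ofLex (σ.outNorm w) = f) ?_ ?_
  · rintro f ⟨⟨σ, rfl⟩, hf⟩
    obtain ⟨q, hq⟩ := PointedMarkedGraph.exists_length_basedWord_le
      (σ := σ.toPointedMarkedGraph) (B := B.toNat)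
      (fun i => by
        have := hf (u (ConjClasses.mk (FreeGroup.of i))) (by simp)
        rw [outNorm_apply σ (hu _)] at this
        exact natCast_le_of_card_mul_le this)
      (fun i j => by
        have := hf (u (ConjClasses.mk (FreeGroup.of i * FreeGroup.of j)))
          (Finset.mem_union_right _ (Finset.mem_image.2 ⟨(i, j), Finset.mem_univ _, rfl⟩))
        rw [outNorm_apply σ (hu _)] at this
        exact natCast_le_of_card_mul_le this)
    exact ⟨_, ⟨σ.toPointedMarkedGraph, q, hq, rfl⟩, σ, q, rfl, rfl⟩
  · rintro F _ _ ⟨σ, q, rfl, rfl⟩ ⟨τ, r, h, rfl⟩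
    funext i
    obtain ⟨α, hα⟩ := ConjClasses.exists_rep (w i)
    rw [outNorm_apply σ hα.symm, outNorm_apply τ hα.symm,
      le_antisymm (PointedMarkedGraph.loopLength_le_of_length_basedWord (congrFun h) α)
        (PointedMarkedGraph.loopLength_le_of_length_basedWord (congrFun h.symm) α)]

/-- Here the generators are bounded at the original base point, so the empty path serves as the
change of base point. -/
theorem finite_autNorm {a : ℕ → FreeGroup (Fin n)} (ha : Function.Surjective a) :
    ∃ I : Finset ℕ, ∀ B : ℤ, {f : ℕ → ℤ | (∃ σ : PointedMarkedGGraph G, ofLex (σ.autNorm a) = f) ∧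
      ∀ i ∈ I, f i ≤ B}.Finite := by
  classical
  choose u hu using ha
  refine ⟨Finset.univ.image fun i => u (FreeGroup.of i), fun B => ?_⟩
  refine (PointedMarkedGraph.finite_setOf_length_basedWord n B.toNat).of_functional
    (fun F f => ∃ σ : PointedMarkedGGraph G,
      (F = fun α => (σ.marking α).nf.length) ∧ ofLex (σ.autNorm a) = f) ?_ ?_
  · rintro f ⟨⟨σ, rfl⟩, hf⟩
    refine ⟨_, ⟨σ.toPointedMarkedGraph, [], fun i => ?_, rfl⟩, σ, ?_, rfl⟩
    · have := hf (u (FreeGroup.of i)) (by simp)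
      rw [autNorm_apply, hu, pathLength_eq] at this
      rw [PointedMarkedGraph.basedWord_nil]
      exact natCast_le_of_card_mul_le this
    · exact funext fun α => congrArg List.length (PointedMarkedGraph.basedWord_nil α)
  · rintro F _ _ ⟨σ, rfl, rfl⟩ ⟨τ, h, rfl⟩
    funext i
    rw [autNorm_apply, autNorm_apply, pathLength_eq, pathLength_eq]
    have := congrFun h (a i)
    rw [this]

/-- Every nonempty set of pointed marked `G`-graphs has an element of least tot-norm. -/
theorem exists_forall_totNorm_le {w : ℕ → ConjClasses (FreeGroup (Fin n))}
    (hw : Function.Surjective w) {a : ℕ → FreeGroup (Fin n)} (ha : Function.Surjective a)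
    {T : Set (PointedMarkedGGraph G)} (hT : T.Nonempty) :
    ∃ σ ∈ T, ∀ τ ∈ T, σ.totNorm w a ≤ τ.totNorm w a := by
  obtain ⟨I, hI⟩ := finite_outNorm (G := G) hw
  obtain ⟨J, hJ⟩ := finite_autNorm (G := G) ha
  obtain ⟨-, ⟨σ₀, hσ₀, rfl⟩, hmin₀⟩ := exists_forall_toLex_le
    (S := (fun σ : PointedMarkedGGraph G => ofLex (σ.outNorm w)) '' T) (hT.image _)
    (by
      rintro _ ⟨σ, -, rfl⟩ i
      exact Finset.sum_nonneg fun x _ => Nat.cast_nonneg _)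
    I (fun B => (hI B).subset (by
      rintro _ ⟨⟨σ, -, rfl⟩, h⟩
      exact ⟨⟨σ, rfl⟩, h⟩))
  -- Second minimisation, among the graphs whose out-norm is already least.
  obtain ⟨-, ⟨σ, ⟨hσ, hσσ₀⟩, rfl⟩, hmin⟩ := exists_forall_toLex_le
    (S := (fun σ : PointedMarkedGGraph G => ofLex (σ.autNorm a)) ''
      {σ ∈ T | σ.outNorm w = σ₀.outNorm w}) ⟨_, σ₀, ⟨hσ₀, rfl⟩, rfl⟩
    (by
      rintro _ ⟨σ, -, rfl⟩ i
      exact Finset.sum_nonneg fun x _ => Nat.cast_nonneg _)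
    J (fun B => (hJ B).subset (by
      rintro _ ⟨⟨σ, -, rfl⟩, h⟩
      exact ⟨⟨σ, rfl⟩, h⟩))
  refine ⟨σ, hσ, fun τ hτ => Prod.Lex.toLex_le_toLex.2 ?_⟩
  have h1 : σ₀.outNorm w ≤ τ.outNorm w := hmin₀ _ ⟨τ, hτ, rfl⟩
  rw [← hσσ₀] at h1
  rcases h1.lt_or_eq with h2 | h2
  · exact Or.inl h2
  · exact Or.inr ⟨h2, hmin _ ⟨τ, ⟨hτ, h2.symm.trans hσσ₀⟩, rfl⟩⟩

end PointedMarkedGGraph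

/-! ### Bijections from relations; common initial segments of reduced paths -/

theorem exists_equiv_of_forall_rel {α β : Type*} {R : α → β → Prop} (h1 : ∀ a, ∃ b, R a b)
    (h2 : ∀ b, ∃ a, R a b) (h3 : ∀ a b b', R a b → R a b' → b = b')
    (h4 : ∀ a a' b, R a b → R a' b → a = a') : ∃ φ : α ≃ β, ∀ a, R a (φ a) := by
  choose f hf using h1
  choose g hg using h2
  exact ⟨⟨f, g, fun a => h4 _ _ _ (hg _) (hf a), fun b => h3 _ _ _ (hf _) (hg b)⟩, hf⟩

namespace SerreGraph

variable {Γ Δ : SerreGraph}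

theorem exists_common_prefix (p q : List Γ.E) : ∃ c p' q', p = c ++ p' ∧ q = c ++ q' ∧
    ∀ e, p'.head? = some e → q'.head? ≠ some e := by
  induction p generalizing q with
  | nil => exact ⟨[], [], q, rfl, rfl, by simp⟩
  | cons e p ih =>
    cases q with
    | nil => exact ⟨[], e :: p, [], rfl, rfl, by simp⟩
    | cons f q =>
      by_cases h : e = f
      · subst h
        obtain ⟨c, p', q', rfl, rfl, h⟩ := ih q
        exact ⟨e :: c, p', q', rfl, rfl, h⟩
      · refine ⟨[], e :: p, f :: q, rfl, rfl, fun g hg hg' => h ?_⟩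
        rw [List.head?_cons] at hg hg'
        exact Option.some.inj (hg.trans hg'.symm)

/-- The length of the common initial segment is determined by the length of the difference. -/
theorem Reduced.take_eq_take_iff {p q : List Γ.E} (hp : Γ.Reduced p) (hq : Γ.Reduced q) {m : ℕ}
    (hmp : m ≤ p.length) (hmq : m ≤ q.length) :
    p.take m = q.take m ↔ (Γ.red (Γ.inv p ++ q)).length + 2 * m ≤ p.length + q.length := by
  obtain ⟨c, p', q', rfl, rfl, h⟩ := exists_common_prefix p q
  -- Once the longest common prefix `c` has cancelled, nothing else does, so the reduced length is
  -- |p| + |q| − 2|c|.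
  have hred : Γ.Reduced (Γ.inv p' ++ q') := by
    refine hp.right.inv.append hq.right fun e he => ?_
    have h1 : p'.head? = some (Γ.rev e) := by
      have h2 : (p'.head?).map Γ.rev = some e := by
        rwa [SerreGraph.inv, List.getLast?_reverse, List.head?_map] at he
      obtain ⟨f, hf, rfl⟩ := Option.map_eq_some_iff.1 h2
      rw [Γ.rev_rev, hf]
    exact h _ h1
  have h1 : Γ.red (Γ.inv (c ++ p') ++ (c ++ q')) = Γ.inv p' ++ q' := by
    rw [inv_append, List.append_assoc, red_append_congr_right _ (red_inv_append_append c q'),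
      hred.red_eq]
  rw [h1]
  simp only [List.length_append, length_inv] at *
  constructor
  · intro h2
    by_contra h3
    obtain ⟨k, rfl⟩ : ∃ k, m = c.length + 1 + k := ⟨m - c.length - 1, by omega⟩
    cases p' with
    | nil => simp at hmp; omega
    | cons e p' =>
      cases q' with
      | nil => simp at hmq; omega
      | cons f q' =>
        have h4 := congrArg (fun l => l[c.length]?) h2
        simp only [List.getElem?_take_of_lt (show c.length < c.length + 1 + k by omega),
          List.getElem?_append_right le_rfl, Nat.sub_self, List.getElem?_cons_zero] at h4
        exact h e rfl h4.symm
  · intro h2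
    have h3 : m ≤ c.length := by omega
    rw [List.take_append_of_le_length h3, List.take_append_of_le_length h3]

theorem take_inv (p : List Γ.E) (m : ℕ) : (Γ.inv p).take m = Γ.inv (p.drop (p.length - m)) := by
  simp [inv, List.take_reverse]

theorem inv_injective : Function.Injective Γ.inv :=
  Function.LeftInverse.injective (g := Γ.inv) inv_inv

theorem getElem?_inv {p : List Γ.E} {k : ℕ} {e : Γ.E} (h : p[k]? = some e) :
    (Γ.inv p)[p.length - 1 - k]? = some (Γ.rev e) := by
  obtain ⟨hk, rfl⟩ := List.getElem?_eq_some_iff.1 h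
  rw [inv, List.getElem?_reverse (by simp; omega)]
  have : p.length - 1 - (p.length - 1 - k) = k := by omega
  simp [this, hk]

theorem IsPath.src_eq {u v : Γ.V} {p : List Γ.E} (hp : Γ.IsPath u p v) {e : Γ.E}
    (h : p[0]? = some e) : Γ.src e = u := by
  cases p with
  | nil => simp at h
  | cons f p =>
    rw [List.getElem?_cons_zero] at h
    rw [← Option.some.inj h]
    exact hp.1

theorem IsPath.tgt_eq_src {u v : Γ.V} {p : List Γ.E} (hp : Γ.IsPath u p v) {k : ℕ} {e f : Γ.E}
    (he : p[k]? = some e) (hf : p[k + 1]? = some f) : Γ.tgt e = Γ.src f := by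
  induction p generalizing u k with
  | nil => simp at he
  | cons g p ih =>
    cases k with
    | zero =>
      rw [List.getElem?_cons_zero] at he
      rw [List.getElem?_cons_succ] at hf
      rw [← Option.some.inj he]
      exact (hp.2.src_eq hf).symm
    | succ k =>
      rw [List.getElem?_cons_succ] at he hf
      exact ih hp.2 he hf

theorem Iso.nf_mapPi1 (f : Iso Γ Δ) {v : Γ.V} {w : Δ.V} (h : f.onV v = w) (γ : Γ.Pi1 v) :
    (f.mapPi1 h γ).nf = γ.nf.map f.onE := by
  have h1 := f.represents_map h (γ := γ) (p := γ.nf) ⟨γ.isPath_nf, γ.mk_nf⟩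
  rw [← h1.red_eq, (f.reduced_map γ.reduced_nf).red_eq]

end SerreGraph

/-! ### Reading edges off the words of group elements -/

namespace PointedMarkedGraph

variable {n : ℕ} (σ τ : PointedMarkedGraph n)

/-- The reduced closed path at the base point that represents `α`. -/
noncomputable def word (α : FreeGroup (Fin n)) : List σ.graph.E := (σ.marking α).nf

/-- The distance of a vertex from the base point. -/
noncomputable def dist (v : σ.graph.V) : ℕ :=
  sInf {k | ∃ p, σ.graph.IsPath v p σ.base ∧ p.length = k}

variable {σ τ}

theorem dist_le {v : σ.graph.V} {p : List σ.graph.E} (h : σ.graph.IsPath v p σ.base) :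
    σ.dist v ≤ p.length := Nat.sInf_le ⟨p, h, rfl⟩

theorem exists_reduced_length_eq_dist (v : σ.graph.V) :
    ∃ p, σ.graph.IsPath v p σ.base ∧ σ.graph.Reduced p ∧ p.length = σ.dist v := by
  obtain ⟨q, hq⟩ := σ.connected v
  obtain ⟨p, hp, hpd⟩ := Nat.sInf_mem (s := {k | ∃ p, σ.graph.IsPath v p σ.base ∧ p.length = k})
    ⟨_, _, σ.graph.isPath_inv hq, rfl⟩
  exact ⟨_, hp.red, reduced_red p, le_antisymm ((length_red_le p).trans hpd.le) (dist_le hp.red)⟩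

theorem exists_src_eq_ne {v : σ.graph.V} (hv : v ≠ σ.base) (e : σ.graph.E) :
    ∃ f, σ.graph.src f = v ∧ f ≠ e := by
  by_contra! h
  have h3 := σ.three_le_valence v hv
  have := σ.finite_E
  have h1 : σ.graph.valence v ≤ 1 := Finite.card_le_one_iff_subsingleton.2
    ⟨fun x y => Subtype.ext ((h x.1 x.2).trans (h y.1 y.2).symm)⟩
  omega

/-- Every edge can be continued to a reduced path which ends at the base point. -/
theorem exists_reduced_cons (e : σ.graph.E) :
    ∃ p, σ.graph.IsPath (σ.graph.tgt e) p σ.base ∧ σ.graph.Reduced (e :: p) := by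
  have := σ.finite_V
  obtain ⟨M, hM⟩ := (Set.finite_range σ.dist).bddAbove
  have hM : ∀ v, σ.dist v ≤ M := fun v => hM ⟨v, rfl⟩
  -- Induction on how far the distance of the end of `e` from the base point can still grow: it
  -- never exceeds `M`.
  suffices H : ∀ (k : ℕ) (e : σ.graph.E), M ≤ σ.dist (σ.graph.tgt e) + k →
      ∃ p, σ.graph.IsPath (σ.graph.tgt e) p σ.base ∧ σ.graph.Reduced (e :: p) from
    H M e (Nat.le_add_left _ _)
  intro k
  induction k with
  | zero => ?_
  | succ k ih => ?_
  all_goals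
    intro e he
    obtain ⟨p, hp, hpr, hpd⟩ := exists_reduced_length_eq_dist (σ.graph.tgt e)
    by_cases hb : σ.graph.tgt e = σ.base
    · exact ⟨[], hb, List.isChain_singleton e⟩
    obtain ⟨g, hg, hge⟩ := exists_src_eq_ne hb (σ.graph.rev e)
    obtain ⟨q, hq, hqr, hqd⟩ := exists_reduced_length_eq_dist (σ.graph.tgt g)
    have hcons : ∀ r, σ.graph.IsPath (σ.graph.tgt g) r σ.base → σ.graph.Reduced (g :: r) →
        ∃ p, σ.graph.IsPath (σ.graph.tgt e) p σ.base ∧ σ.graph.Reduced (e :: p) :=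
      fun r h1 h2 => ⟨g :: r, ⟨hg, h1⟩, List.isChain_cons_cons.2 ⟨hge, h2⟩⟩
    -- Follow `e` by `g` and a shortest path `q` home. This fails to be reduced only if `q` starts
    -- by reversing `g`; then `g` ends farther from the base point than `e`, which is impossible at
    -- the maximum and is otherwise the inductive case.
    cases q with
    | nil => exact hcons [] hq (List.isChain_singleton g)
    | cons h t =>
      by_cases hh : h = σ.graph.rev g
      swap
      · exact hcons _ hq (List.isChain_cons_cons.2 ⟨hh, hqr⟩)
      subst hh
      have h1 := dist_le hq.2
      rw [tgt_rev, hg] at h1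
      rw [List.length_cons] at hqd
      have h2 := hM (σ.graph.tgt g)
      first
        | omega
        | obtain ⟨r, hr, hgr⟩ := ih g (by omega)
          exact hcons r hr hgr

theorem exists_reduced_append_singleton (e : σ.graph.E) :
    ∃ p, σ.graph.IsPath σ.base p (σ.graph.src e) ∧ σ.graph.Reduced (p ++ [e]) := by
  obtain ⟨p, hp, hr⟩ := exists_reduced_cons (σ.graph.rev e)
  rw [tgt_rev] at hp
  refine ⟨σ.graph.inv p, σ.graph.isPath_inv hp, ?_⟩
  have := hr.inv
  rwa [inv_cons, σ.graph.rev_rev] at this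

theorem reduced_word (α : FreeGroup (Fin n)) : σ.graph.Reduced (σ.word α) := Pi1.reduced_nf _

theorem isPath_word (α : FreeGroup (Fin n)) : σ.graph.IsPath σ.base (σ.word α) σ.base :=
  Pi1.isPath_nf _

theorem word_inv (α : FreeGroup (Fin n)) : σ.word α⁻¹ = σ.graph.inv (σ.word α) := by
  rw [word, map_inv, Pi1.nf_inv]; rfl

theorem word_inv_mul (α β : FreeGroup (Fin n)) :
    σ.word (α⁻¹ * β) = σ.graph.red (σ.graph.inv (σ.word α) ++ σ.word β) := by
  rw [word, map_mul, map_inv, Pi1.nf_mul, Pi1.nf_inv]; rfl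

theorem exists_word_eq {p : List σ.graph.E} (hp : σ.graph.IsPath σ.base p σ.base)
    (hr : σ.graph.Reduced p) : ∃ α, σ.word α = p := by
  refine ⟨σ.marking.symm (Pi1.mk ⟨p, hp⟩), ?_⟩
  rw [word, MulEquiv.apply_symm_apply, Pi1.nf_mk, hr.red_eq]

theorem exists_getElem?_word_zero {e : σ.graph.E} (he : σ.graph.src e = σ.base) :
    ∃ α, (σ.word α)[0]? = some e := by
  obtain ⟨p, hp, hr⟩ := exists_reduced_cons e
  obtain ⟨α, hα⟩ := exists_word_eq (p := e :: p) ⟨he, hp⟩ hr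
  exact ⟨α, by rw [hα]; rfl⟩

theorem exists_getElem?_word (e : σ.graph.E) :
    ∃ (α : FreeGroup (Fin n)) (k : ℕ), (σ.word α)[k]? = some e := by
  obtain ⟨p, hp, hr⟩ := exists_reduced_cons e
  obtain ⟨q, hq, hqr⟩ := exists_reduced_append_singleton e
  obtain ⟨α, hα⟩ := exists_word_eq (p := q ++ e :: p) (σ.graph.isPath_append hq ⟨rfl, hp⟩)
    (hqr.append_singleton_cons hr)
  exact ⟨α, q.length, by rw [hα]; simp⟩

/-- Turns, and not only edges, occur in words; this is what lets lengths detect that two edges share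
a vertex. -/
theorem exists_getElem?_word_succ {e f : σ.graph.E} (h : σ.graph.tgt e = σ.graph.src f)
    (hef : f ≠ σ.graph.rev e) :
    ∃ (α : FreeGroup (Fin n)) (k : ℕ), (σ.word α)[k]? = some e ∧ (σ.word α)[k + 1]? = some f := by
  obtain ⟨p, hp, hr⟩ := exists_reduced_cons f
  obtain ⟨q, hq, hqr⟩ := exists_reduced_append_singleton e
  obtain ⟨α, hα⟩ := exists_word_eq (p := q ++ e :: f :: p)
    (σ.graph.isPath_append hq ⟨rfl, h.symm, hp⟩)
    (hqr.append_singleton_cons (List.isChain_cons_cons.2 ⟨hef, hr⟩))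
  refine ⟨α, q.length, by rw [hα]; simp, ?_⟩
  rw [hα, List.getElem?_append_right (Nat.le_succ _)]
  simp

/-- Occurrences of the same edge are detected by initial and final segments of words. -/
theorem getElem?_word_eq_iff {α β : FreeGroup (Fin n)} {k l : ℕ} (hk : k < (σ.word α).length)
    (hl : l < (σ.word β).length) :
    (σ.word α)[k]? = (σ.word β)[l]? ↔
      ∃ γ, (σ.word γ).length + l = k + (σ.word β).length ∧
        (σ.word α).take (k + 1) = (σ.word γ).take (k + 1) ∧
        (σ.word γ).drop k = (σ.word β).drop l := by
  constructor
  · intro h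
    have hα := List.take_append_drop k (σ.word α)
    have hβ := List.take_append_drop l (σ.word β)
    rw [List.drop_eq_getElem_cons hk] at hα
    rw [List.drop_eq_getElem_cons hl] at hβ
    rw [List.getElem?_eq_getElem hk, List.getElem?_eq_getElem hl] at h
    have h := Option.some.inj h
    have hpα := isPath_word (σ := σ) α
    have hpβ := isPath_word (σ := σ) β
    have hrα := reduced_word (σ := σ) α
    have hrβ := reduced_word (σ := σ) β
    rw [← hα] at hpα hrα
    rw [← hβ] at hpβ hrβ
    obtain ⟨v, h1, h2⟩ := isPath_append_iff.1 hpα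
    obtain ⟨w, h3, h4⟩ := isPath_append_iff.1 hpβ
    have hvw : w = v := by rw [← h2.1, ← h4.1, h]
    subst hvw
    -- The element γ reads the word of `α` before position `k`, then that of `β` from position `l`;
    -- the paths meet since the two edges agree.
    obtain ⟨γ, hγ⟩ := exists_word_eq (σ.graph.isPath_append h1 h4)
      (Reduced.append_singleton_cons (p := (σ.word α).take k) (e := (σ.word β)[l])
        (by rw [← h]; exact (List.isChain_split.1 hrα).1) (List.isChain_split.1 hrβ).2)
    have hlen : ((σ.word α).take k).length = k := by simp; omega
    refine ⟨γ, ?_, ?_, ?_⟩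
    · rw [hγ]
      simp
      omega
    · have h5 : k + 1 - k = 1 := by omega
      rw [hγ, ← h, List.take_append, hlen, h5,
        List.take_of_length_le (l := (σ.word α).take k) (by omega)]
      simp
    · rw [hγ, List.drop_append, hlen, Nat.sub_self, List.drop_zero, ← List.drop_eq_getElem_cons hl]
      simp
  · rintro ⟨γ, h1, h2, h3⟩
    have h4 := congrArg (fun p => p[k]?) h2
    have h5 := congrArg (fun p => p[0]?) h3
    simp only [List.getElem?_take_of_lt (Nat.lt_succ_self k), List.getElem?_drop,
      Nat.add_zero] at h4 h5
    rw [h4, h5]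

theorem take_word_eq_iff {α β : FreeGroup (Fin n)} {m : ℕ} (hα : m ≤ (σ.word α).length)
    (hβ : m ≤ (σ.word β).length) :
    (σ.word α).take m = (σ.word β).take m ↔
      (σ.word (α⁻¹ * β)).length + 2 * m ≤ (σ.word α).length + (σ.word β).length := by
  rw [(reduced_word α).take_eq_take_iff (reduced_word β) hα hβ, word_inv_mul]

/-- Final segments are initial segments of inverses, so they too are governed by `take_word_eq_iff`.
-/
theorem drop_word_eq_iff {α β : FreeGroup (Fin n)} {k l : ℕ}
    (h : (σ.word α).length + l = k + (σ.word β).length) (hl : l ≤ (σ.word β).length) :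
    (σ.word α).drop k = (σ.word β).drop l ↔
      (σ.word α⁻¹).take ((σ.word β).length - l) = (σ.word β⁻¹).take ((σ.word β).length - l) := by
  have h1 : (σ.word α).length - ((σ.word β).length - l) = k := by omega
  have h2 : (σ.word β).length - ((σ.word β).length - l) = l := by omega
  rw [word_inv, word_inv, take_inv, take_inv, inv_injective.eq_iff, h1, h2]

theorem length_word_inv (α : FreeGroup (Fin n)) : (σ.word α⁻¹).length = (σ.word α).length := by
  rw [word_inv, length_inv]

/-- The criterion `getElem?_word_eq_iff`, with the same γ, unfolds to conditions on lengths only,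
and these carry over from one graph to the other. -/
theorem getElem?_word_eq_of_length_eq (hL : ∀ α, (σ.word α).length = (τ.word α).length)
    {α β : FreeGroup (Fin n)} {k l : ℕ} (hk : k < (σ.word α).length)
    (hl : l < (σ.word β).length) (h : (σ.word α)[k]? = (σ.word β)[l]?) :
    (τ.word α)[k]? = (τ.word β)[l]? := by
  obtain ⟨γ, h1, h2, h3⟩ := (getElem?_word_eq_iff hk hl).1 h
  rw [take_word_eq_iff (by omega) (by omega)] at h2
  rw [drop_word_eq_iff h1 hl.le, take_word_eq_iff (by rw [length_word_inv]; omega)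
    (by rw [length_word_inv]; omega)] at h3
  simp only [hL] at hk hl h1 h2 h3
  refine (getElem?_word_eq_iff hk hl).2 ⟨γ, h1, ?_, ?_⟩
  · rwa [take_word_eq_iff (by omega) (by omega)]
  · rwa [drop_word_eq_iff h1 hl.le, take_word_eq_iff (by rw [length_word_inv]; omega)
      (by rw [length_word_inv]; omega)]

end PointedMarkedGraph

/-! ### The isomorphism determined by a based length function -/

namespace PointedMarkedGraph

variable {n : ℕ} (σ τ : PointedMarkedGraph n)

/-- Two edges correspond if they occur in the same place of the words of some element. -/
def EdgeRel (e : σ.graph.E) (e' : τ.graph.E) : Prop :=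
  ∃ (α : FreeGroup (Fin n)) (k : ℕ), (σ.word α)[k]? = some e ∧ (τ.word α)[k]? = some e'

/-- The correspondence of vertices induced by the correspondence of edges. -/
def VertexRel (v : σ.graph.V) (v' : τ.graph.V) : Prop :=
  (v = σ.base ∧ v' = τ.base) ∨
    ∃ e e', EdgeRel σ τ e e' ∧ σ.graph.src e = v ∧ τ.graph.src e' = v'

variable {σ τ}

theorem EdgeRel.symm {e : σ.graph.E} {e' : τ.graph.E} (h : EdgeRel σ τ e e') :
    EdgeRel τ σ e' e :=
  let ⟨α, k, h1, h2⟩ := h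
  ⟨α, k, h2, h1⟩

theorem VertexRel.symm {v : σ.graph.V} {v' : τ.graph.V} (h : VertexRel σ τ v v') :
    VertexRel τ σ v' v := by
  rcases h with ⟨h1, h2⟩ | ⟨e, e', h, h1, h2⟩
  · exact Or.inl ⟨h2, h1⟩
  · exact Or.inr ⟨e', e, h.symm, h2, h1⟩

section

variable (hL : ∀ α, (σ.word α).length = (τ.word α).length)

include hL

theorem edgeRel_of_getElem? {α : FreeGroup (Fin n)} {k : ℕ} {e : σ.graph.E}
    (h : (σ.word α)[k]? = some e) :
    ∃ e', EdgeRel σ τ e e' ∧ (τ.word α)[k]? = some e' := by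
  obtain ⟨hk, -⟩ := List.getElem?_eq_some_iff.1 h
  rw [hL] at hk
  exact ⟨(τ.word α)[k], ⟨α, k, h, List.getElem?_eq_getElem hk⟩, List.getElem?_eq_getElem hk⟩

theorem exists_edgeRel (e : σ.graph.E) : ∃ e', EdgeRel σ τ e e' := by
  obtain ⟨α, k, h⟩ := exists_getElem?_word e
  obtain ⟨e', h', -⟩ := edgeRel_of_getElem? hL h
  exact ⟨e', h'⟩

theorem EdgeRel.right_unique {e : σ.graph.E} {e₁ e₂ : τ.graph.E} (h₁ : EdgeRel σ τ e e₁)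
    (h₂ : EdgeRel σ τ e e₂) : e₁ = e₂ := by
  obtain ⟨α, k, h1, h2⟩ := h₁
  obtain ⟨β, l, h3, h4⟩ := h₂
  have := getElem?_word_eq_of_length_eq hL (List.getElem?_eq_some_iff.1 h1).1
    (List.getElem?_eq_some_iff.1 h3).1 (h1.trans h3.symm)
  rw [h2, h4] at this
  exact Option.some.inj this

theorem EdgeRel.rev {e : σ.graph.E} {e' : τ.graph.E} (h : EdgeRel σ τ e e') :
    EdgeRel σ τ (σ.graph.rev e) (τ.graph.rev e') := by
  obtain ⟨α, k, h1, h2⟩ := h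
  refine ⟨α⁻¹, (σ.word α).length - 1 - k, ?_, ?_⟩
  · rw [word_inv, getElem?_inv h1]
  · rw [word_inv, hL, getElem?_inv h2]

/-- An edge issuing from the base point is the first letter of some word, and so is its counterpart.
-/
theorem EdgeRel.src_eq_base {e : σ.graph.E} {e' : τ.graph.E} (h : EdgeRel σ τ e e')
    (he : σ.graph.src e = σ.base) : τ.graph.src e' = τ.base := by
  obtain ⟨α, hα⟩ := exists_getElem?_word_zero he
  obtain ⟨e₁, h₁, hα'⟩ := edgeRel_of_getElem? hL hα
  rw [h.right_unique hL h₁]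
  exact (isPath_word α).src_eq hα'

/-- For distinct edges with a common source, `rev e` followed by `f` is a turn of some word; the
counterparts are consecutive in the other word. -/
theorem EdgeRel.src_eq_src {e f : σ.graph.E} {e' f' : τ.graph.E} (he : EdgeRel σ τ e e')
    (hf : EdgeRel σ τ f f') (h : σ.graph.src e = σ.graph.src f) :
    τ.graph.src e' = τ.graph.src f' := by
  by_cases hef : f = e
  · subst hef
    rw [he.right_unique hL hf]
  obtain ⟨α, k, h1, h2⟩ := exists_getElem?_word_succ (e := σ.graph.rev e) (f := f)
    (by rw [tgt_rev, h]) (by rwa [σ.graph.rev_rev])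
  obtain ⟨x, hx, h3⟩ := edgeRel_of_getElem? hL h1
  obtain ⟨y, hy, h4⟩ := edgeRel_of_getElem? hL h2
  have h5 := (isPath_word α).tgt_eq_src h3 h4
  rw [hx.right_unique hL (he.rev hL), hy.right_unique hL hf, tgt_rev] at h5
  exact h5

theorem VertexRel.right_unique {v : σ.graph.V} {v₁ v₂ : τ.graph.V} (h₁ : VertexRel σ τ v v₁)
    (h₂ : VertexRel σ τ v v₂) : v₁ = v₂ := by
  rcases h₁ with ⟨rfl, rfl⟩ | ⟨e, e', he, rfl, rfl⟩
  · rcases h₂ with ⟨-, rfl⟩ | ⟨f, f', hf, h, rfl⟩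
    · rfl
    · exact (hf.src_eq_base hL h).symm
  · rcases h₂ with ⟨h, rfl⟩ | ⟨f, f', hf, h, rfl⟩
    · exact he.src_eq_base hL h
    · exact he.src_eq_src hL hf h.symm

theorem exists_vertexRel (v : σ.graph.V) : ∃ v', VertexRel σ τ v v' := by
  -- The base point is separate because it may have no edges, as in the one-vertex graph for rank
  -- zero.
  by_cases hv : v = σ.base
  · exact ⟨τ.base, Or.inl ⟨hv, rfl⟩⟩
  have : Nonempty {e : σ.graph.E // σ.graph.src e = v} := by
    have := σ.three_le_valence v hv
    exact (Nat.card_pos_iff.1 (lt_of_lt_of_le (by norm_num) this)).1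
  obtain ⟨e, he⟩ := this
  obtain ⟨e', he'⟩ := exists_edgeRel hL e
  exact ⟨_, Or.inr ⟨e, e', he', he, rfl⟩⟩

/-- A pointed marked graph is determined by its based length function. -/
theorem exists_iso_of_length_word_eq : ∃ f : Iso σ.graph τ.graph,
    (∀ e, EdgeRel σ τ e (f.onE e)) ∧ ∀ v, VertexRel σ τ v (f.onV v) := by
  obtain ⟨φ, hφ⟩ := exists_equiv_of_forall_rel (R := EdgeRel σ τ) (exists_edgeRel hL)
    (fun e => (exists_edgeRel (fun α => (hL α).symm) e).imp fun _ h => h.symm)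
    (fun _ _ _ h h' => h.right_unique hL h')
    (fun _ _ _ h h' => h.symm.right_unique (fun α => (hL α).symm) h'.symm)
  obtain ⟨ψ, hψ⟩ := exists_equiv_of_forall_rel (R := VertexRel σ τ) (exists_vertexRel hL)
    (fun e => (exists_vertexRel (fun α => (hL α).symm) e).imp fun _ h => h.symm)
    (fun _ _ _ h h' => h.right_unique hL h')
    (fun _ _ _ h h' => h.symm.right_unique (fun α => (hL α).symm) h'.symm)
  exact ⟨⟨ψ, φ, fun e => VertexRel.right_unique hL (Or.inr ⟨e, φ e, hφ e, rfl, rfl⟩) (hψ _),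
    fun e => ((hφ e).rev hL).right_unique hL (hφ _)⟩, hφ, hψ⟩

end

end PointedMarkedGraph

/-! ### Equivariance and uniqueness -/

namespace PointedMarkedGGraph

variable {n : ℕ} {G : Subgroup (MulAut (FreeGroup (Fin n)))}

theorem word_apply (σ : PointedMarkedGGraph G) (x : G) (α : FreeGroup (Fin n)) :
    σ.word ((x : MulAut (FreeGroup (Fin n))) α) = (σ.word α).map (σ.act x).onE := by
  rw [PointedMarkedGraph.word, ← σ.act_marking, Iso.nf_mapPi1]
  rfl

/-- In both graphs `x` carries the k-th letter of α to the k-th letter of xα. -/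
theorem edgeRel_act {σ τ : PointedMarkedGGraph G} {e : σ.graph.E} {e' : τ.graph.E}
    (h : PointedMarkedGraph.EdgeRel σ.toPointedMarkedGraph τ.toPointedMarkedGraph e e') (x : G) :
    PointedMarkedGraph.EdgeRel σ.toPointedMarkedGraph τ.toPointedMarkedGraph
      ((σ.act x).onE e) ((τ.act x).onE e') := by
  obtain ⟨α, k, h1, h2⟩ := h
  refine ⟨(x : MulAut (FreeGroup (Fin n))) α, k, ?_, ?_⟩
  · rw [word_apply, List.getElem?_map, h1]; rfl
  · rw [word_apply, List.getElem?_map, h2]; rfl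

theorem vertexRel_act {σ τ : PointedMarkedGGraph G} {v : σ.graph.V} {v' : τ.graph.V}
    (h : PointedMarkedGraph.VertexRel σ.toPointedMarkedGraph τ.toPointedMarkedGraph v v')
    (x : G) :
    PointedMarkedGraph.VertexRel σ.toPointedMarkedGraph τ.toPointedMarkedGraph
      ((σ.act x).onV v) ((τ.act x).onV v') := by
  rcases h with ⟨rfl, rfl⟩ | ⟨e, e', h, rfl, rfl⟩
  · exact Or.inl ⟨σ.act_base x, τ.act_base x⟩
  · exact Or.inr ⟨_, _, edgeRel_act h x, (σ.act x).map_src e, (τ.act x).map_src e'⟩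

/-- Corresponding edges and vertices are unique, so compatibility with markings and with G only
requires that both sides correspond to the same edge or vertex. -/
theorem equivalent_of_length_word_eq {σ τ : PointedMarkedGGraph G}
    (hL : ∀ α, (σ.word α).length = (τ.word α).length) : Equivalent σ τ := by
  obtain ⟨f, hE, hV⟩ := PointedMarkedGraph.exists_iso_of_length_word_eq hL
  have hb : f.onV σ.base = τ.base :=
    (hV σ.base).right_unique hL (Or.inl ⟨rfl, rfl⟩)
  refine ⟨f, hb, fun α => Pi1.nf_injective ?_, fun x => Iso.ext (Equiv.ext fun v => ?_)
    (Equiv.ext fun e => ?_)⟩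
  · rw [Iso.nf_mapPi1]
    change (σ.word α).map f.onE = τ.word α
    refine List.ext_getElem (by rw [List.length_map, hL]) fun k h1 h2 => ?_
    rw [List.length_map] at h1
    rw [List.getElem_map]
    exact (hE _).right_unique hL
      ⟨α, k, List.getElem?_eq_getElem h1, List.getElem?_eq_getElem h2⟩
  · exact (hV _).right_unique hL (vertexRel_act (hV v) x)
  · exact (hE _).right_unique hL (edgeRel_act (hE e) x)

variable [Fintype G]

/-- Pointed marked `G`-graphs with the same aut-norm are equivalent. -/
theorem equivalent_of_autNorm_eq {a : ℕ → FreeGroup (Fin n)} (ha : Function.Surjective a)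
    {σ τ : PointedMarkedGGraph G} (h : σ.autNorm a = τ.autNorm a) : Equivalent σ τ := by
  refine equivalent_of_length_word_eq fun α => ?_
  obtain ⟨i, rfl⟩ := ha α
  have h1 := congrArg (fun f : Lex (ℕ → ℤ) => ofLex f i) h
  simp only [autNorm_apply, pathLength_eq] at h1
  have h2 : (Fintype.card G : ℤ) ≠ 0 := by exact_mod_cast Fintype.card_ne_zero
  exact_mod_cast mul_left_cancel₀ h2 h1

end PointedMarkedGGraph

theorem mainTheorem2 (n : ℕ) (G : Subgroup (MulAut (FreeGroup (Fin n)))) [Fintype G]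
    (w : ℕ → ConjClasses (FreeGroup (Fin n))) (hw : Function.Surjective w)
    (a : ℕ → FreeGroup (Fin n)) (ha : Function.Surjective a) :
    IsWellOrder (PointedMarkedGGraphClass G)
      (fun σ τ => PointedMarkedGGraphClass.totNorm w a σ <
        PointedMarkedGGraphClass.totNorm w a τ) := by
  refine { wf := WellFounded.wellFounded_iff_has_min.2 fun S hS => ?_, trichotomous := ?_ }
  · obtain ⟨c, hc⟩ := hS
    obtain ⟨σ₀, rfl⟩ := Quotient.exists_rep c
    obtain ⟨σ, hσ, hmin⟩ := PointedMarkedGGraph.exists_forall_totNorm_le hw ha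
      (T := {σ | (Quotient.mk _ σ : PointedMarkedGGraphClass G) ∈ S}) ⟨σ₀, hc⟩
    refine ⟨_, hσ, fun d hd => ?_⟩
    obtain ⟨τ, rfl⟩ := Quotient.exists_rep d
    exact not_lt.2 (hmin τ hd)
  · intro c d h1 h2
    obtain ⟨σ, rfl⟩ := Quotient.exists_rep c
    obtain ⟨τ, rfl⟩ := Quotient.exists_rep d
    have h3 : σ.totNorm w a = τ.totNorm w a := le_antisymm (not_lt.1 h2) (not_lt.1 h1)
    exact Quotient.sound (PointedMarkedGGraph.equivalent_of_autNorm_eq ha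
      (congrArg (fun x => (ofLex x).2) h3))
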